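/- Let $\beta\ge 0$. For every integer $N\ge 1$ let $(\tilde X_N(i,j))_{1\le i,j\le N}$ be $N^2$ real random variables on some probability space which are Curie–Weiss distributed with inverse temperature $\beta$, i.e. for every $x=(x_{ij})\in\{-1,1\}^{N^2}$ $$\mathbb P\big(\tilde X_N(i,j)=x_{ij}\text{ for all }i,j\big)=Z_{\beta,N^2}^{-1}\,\exp\Big(\frac{\beta}{2N^2}\Big(\sum_{i,j=1}^N x_{ij}\Big)^2\Big),$$ where $Z_{\beta,N^2}$ is the constant that makes these probabilities sum to $1$. Let $X_N$ be the symmetric random $N\times N$ matrix (the full Curie–Weiss ensemble) with $X_N(i,j)=\tilde X_N(i,j)$ for $i\le j$ and $X_N(i,j)=\tilde X_N(j,i)$ for $i>j$. Let $\sigma_N=\frac1N\sum_{j=1}^N\delta_{\lambda_j}$, where $\lambda_1,\dots,\lambda_N$ are the eigenvalues, counted with multiplicity, of $\frac1{\sqrt N}X_N$. Put $m(\beta)=0$ if $\beta\le 1$; if $\beta>1$, the equation $\tanh(\beta m)=m$ has exactly one solution $m>0$, and $m(\beta)$ denotes this solution. Let $v(\beta)=1-m(\beta)^2$. Then $\sigma_N$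 converges weakly in probability to the semicircle distribution $\sigma_{v(\beta)}$ with Lebesgue density $$\sigma_{v(\beta)}(x)=\begin{cases}\dfrac{1}{2\pi v(\beta)}\sqrt{4v(\beta)-x^2}&\text{for }|x|\le 2\sqrt{v(\beta)},\\ 0&\text{otherwise,}\end{cases}$$ that is, for every bounded continuous $f:\mathbb R\to\mathbb R$ and every $\varepsilon>0$, $$\mathbb P\Big(\Big|\int f\,d\sigma_N-\int f(x)\,\sigma_{v(\beta)}(x)\,dx\Big|>\varepsilon\Big)\longrightarrow 0\qquad(N\to\infty).$$ -/

import Mathlib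

open MeasureTheory Filter Topology
open scoped BoundedContinuousFunction ENNReal

noncomputable section

namespace CurieWeiss

/-- The unnormalized weight `exp (β / (2 M) * (∑ i, x i) ^ 2)` of a spin configuration
`x ∈ {-1, 1} ^ M`. Here `M` is the cardinality of the index set `ι`, and `{-1, 1}` is `ℤˣ`. -/
def weight (β : ℝ) {ι : Type*} [Fintype ι] (x : ι → ℤˣ) : ℝ :=
  Real.exp (β / (2 * (Fintype.card ι : ℝ)) * (∑ i, ((x i : ℤ) : ℝ)) ^ 2)

/-- The normalization constant `Z`. -/
def partitionFunction (β : ℝ) (ι : Type*) [Fintype ι] [DecidableEq ι] : ℝ :=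
  ∑ x : ι → ℤˣ, weight β x

/-- The family `ξ` consists of Curie-Weiss random variables at inverse temperature `β`: each
configuration `x ∈ {-1, 1} ^ M` is taken with probability `Z⁻¹ exp (β / (2 M) * (∑ i, x i) ^ 2)`.
These probabilities sum to one, so that `ξ` is almost surely `{-1, 1} ^ M`-valued. -/
structure IsCurieWeiss (β : ℝ) {ι : Type*} [Fintype ι] [DecidableEq ι] {Ω : Type*}
    [MeasurableSpace Ω] (P : Measure Ω) (ξ : ι → Ω → ℝ) : Prop where
  measurable : ∀ i, Measurable (ξ i)
  prob_eq : ∀ x : ι → ℤˣ, P {ω | ∀ i, ξ i ω = ((x i : ℤ) : ℝ)} =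
    ENNReal.ofReal ((partitionFunction β ι)⁻¹ * weight β x)

/-- The symmetric matrix whose entries on and above the diagonal are those of `x`. -/
def symmFill {N : ℕ} (x : Fin N × Fin N → ℝ) : Matrix (Fin N) (Fin N) ℝ :=
  Matrix.of fun i j => if i ≤ j then x (i, j) else x (j, i)

theorem symmFill_isHermitian {N : ℕ} (x : Fin N × Fin N → ℝ) : (symmFill x).IsHermitian := by
  ext i j
  simp only [Matrix.conjTranspose_apply, symmFill, Matrix.of_apply, star_trivial]
  rcases lt_trichotomy i j with h | h | h
  · simp [h.le, h.not_ge]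
  · simp [h]
  · simp [h.le, h.not_ge]

/-- The normalized matrix `X / √N`, where `X` is the symmetric filling by `x`. -/
def normalizedMatrix {N : ℕ} (x : Fin N × Fin N → ℝ) : Matrix (Fin N) (Fin N) ℝ :=
  (1 / √(N : ℝ)) • symmFill x

theorem normalizedMatrix_isHermitian {N : ℕ} (x : Fin N × Fin N → ℝ) :
    (normalizedMatrix x).IsHermitian := by
  have h := symmFill_isHermitian x
  unfold Matrix.IsHermitian at h ⊢
  rw [normalizedMatrix, Matrix.conjTranspose_smul, h, star_trivial]

/-- The eigenvalue distribution measure `(1 / N) ∑ j, δ_{λ_j(M)}` of a real symmetric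
`N × N` matrix `M`; eigenvalues are counted with multiplicity. -/
def eigenvalueDistribution {N : ℕ} (M : Matrix (Fin N) (Fin N) ℝ) (hM : M.IsHermitian) :
    Measure ℝ :=
  (N : ℝ≥0∞)⁻¹ • ∑ j, Measure.dirac (hM.eigenvalues j)

/-- The semicircle distribution of variance `v > 0`, given by its Lebesgue density. -/
def semicircle (v : ℝ) : Measure ℝ :=
  volume.withDensity fun x => ENNReal.ofReal
    (if |x| ≤ 2 * √v then 1 / (2 * Real.pi * v) * √(4 * v - x ^ 2) else 0)

/-- `m` is the limiting magnetization `m(β)`: it is `0` for `β ≤ 1`, and a positive solution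
of `tanh (β m) = m` for `β > 1`. -/
def IsMagnetization (β m : ℝ) : Prop :=
  (β ≤ 1 ∧ m = 0) ∨ (1 < β ∧ 0 < m ∧ Real.tanh (β * m) = m)

/-- The random measures `μ N` on `ℝ` converge to the measure `ν` weakly in probability. The
`μ N` may live on different probability spaces; a single space is the case of a constant `Ω`. -/
def TendstoWeaklyInProbability {Ω : ℕ → Type*} [∀ N, MeasurableSpace (Ω N)]
    (P : ∀ N, Measure (Ω N)) (μ : ∀ N, Ω N → Measure ℝ) (ν : Measure ℝ) : Prop :=
  ∀ f : ℝ →ᵇ ℝ, ∀ ε : ℝ, 0 < ε →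
    Tendsto (fun N => P N {ω | ε < |∫ x, f x ∂(μ N ω) - ∫ x, f x ∂ν|}) atTop (𝓝 0)

end CurieWeiss

end

noncomputable section

namespace CurieWeiss

/-! ### The magnetization -/

/-! Curie–Weiss spins are a mixture of independent ones. For M = N² spins with sum S, writing
exp(βS²/(2M)) as a Gaussian integral of exp(Sy - My²/(2β)) over y shows that their law averages the
product laws of mean t = tanh y, where y has density proportional to G(y)^M and G(y) = exp(-y²/(2β))
cosh y (`mixDensity_pow_mul_prodWeight`, `exists_weight_eq`). As M grows this density concentrates
on the maximizers of G (`tendsto_laplace`), where tanh² y = m² (`tanh_sq_of_mixDensity_max`). The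
spins thus look independent with variance 1 - t² close to 1 - m²; the sign of t, still random for β
> 1, plays no role.

For independent spins of mean t, the Stieltjes transform s of the eigenvalue distribution nearly
solves 1 + zs + (1 - t²)s² = 0. The left side is `defect`; integration by parts in every spin bounds
its mean square by O(N^(-1/2)), uniformly in |t| ≤ 1 (`sum_prodWeight_norm_defect_sq_le`). No
centring is needed: the mean enters through t times the sum of all resolvent entries, which is O(N)
and not O(N²). The semicircle transform solves the limiting equation exactly
(`semicircleStieltjes_eq`), and the equation is stable in the upper half-plane
(`norm_sub_semicircleStieltjes_le`), so s converges to it in mean.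

By Stone–Weierstrass, the constants and the functions 1/(x - z) span a dense space of functions on
the one-point compactification of ℝ (`invSubSpan_topologicalClosure`), which extends the convergence
to continuous functions with a limit at infinity. Since the limit measure has mass one, no mass
escapes, and a cutoff reaches all bounded continuous functions (`tendsto_discrepancy`). Markov's
inequality (`IsCurieWeiss.measure_le`) turns convergence in mean into convergence in probability. -/

theorem hasDerivAt_tanh (x : ℝ) : HasDerivAt Real.tanh (1 - Real.tanh x ^ 2) x := by
  have h := (Real.hasDerivAt_sinh x).div (Real.hasDerivAt_cosh x) (Real.cosh_pos x).ne'
  have e : Real.sinh / Real.cosh = Real.tanh := by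
    funext y; simp [Real.tanh_eq_sinh_div_cosh]
  rw [e] at h
  refine h.congr_deriv ?_
  have := (Real.cosh_pos x).ne'
  rw [Real.tanh_eq_sinh_div_cosh]
  field_simp

theorem continuous_tanh : Continuous Real.tanh :=
  continuous_iff_continuousAt.2 fun x => (hasDerivAt_tanh x).continuousAt

theorem strictMono_tanh : StrictMono Real.tanh := by
  refine strictMono_of_deriv_pos fun x => ?_
  rw [(hasDerivAt_tanh x).deriv]
  linarith [Real.tanh_sq_lt_one x]

theorem hasDerivAt_tanh_mul_sub (β x : ℝ) :
    HasDerivAt (fun m => Real.tanh (β * m) - m) (β * (1 - Real.tanh (β * x) ^ 2) - 1) x := by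
  have h := (hasDerivAt_tanh (β * x)).comp x ((hasDerivAt_id x).const_mul β)
  exact (h.sub (hasDerivAt_id x)).congr_deriv (by simp; ring)

theorem strictConcaveOn_tanh_mul_sub {β : ℝ} (hβ : 0 < β) :
    StrictConcaveOn ℝ (Set.Ici 0) (fun m => Real.tanh (β * m) - m) := by
  refine StrictAntiOn.strictConcaveOn_of_deriv (convex_Ici 0)
    (fun x _ => (hasDerivAt_tanh_mul_sub β x).continuousAt.continuousWithinAt) ?_
  rw [interior_Ici]
  intro x hx y hy hxy
  rw [(hasDerivAt_tanh_mul_sub β x).deriv, (hasDerivAt_tanh_mul_sub β y).deriv]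
  have hx0 : 0 < x := hx
  have h1 : 0 < Real.tanh (β * x) := by
    simpa using strictMono_tanh (show (0 : ℝ) < β * x by positivity)
  have h2 : Real.tanh (β * x) < Real.tanh (β * y) := strictMono_tanh (by gcongr)
  have h3 : Real.tanh (β * x) ^ 2 < Real.tanh (β * y) ^ 2 := by gcongr
  have := mul_lt_mul_of_pos_left h3 hβ
  linarith

/-- A strictly concave function on `[0, ∞)` vanishing at `0` is larger than the chord. -/
theorem tanh_mul_gt_of_eq {β m y : ℝ} (hβ : 0 < β) (hm : Real.tanh (β * m) = m) (hy : 0 < y)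
    (hym : y < m) : y < Real.tanh (β * y) := by
  have hm0 : 0 < m := hy.trans hym
  have h := (strictConcaveOn_tanh_mul_sub hβ).2 (Set.mem_Ici.2 le_rfl) (Set.mem_Ici.2 hm0.le)
    hm0.ne (sub_pos.2 ((div_lt_one hm0).2 hym)) (div_pos hy hm0) (sub_add_cancel _ _)
  simp only [smul_eq_mul, mul_zero, zero_add, hm, sub_self, Real.tanh_zero, add_zero] at h
  rw [div_mul_cancel₀ _ hm0.ne'] at h
  linarith

/-- For β ≤ 1 this rules out nonzero critical points of `mixDensity`. -/
theorem tanh_lt_self {x : ℝ} (hx : 0 < x) : Real.tanh x < x := by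
  by_contra! h
  have hanti : StrictAntiOn (fun m => Real.tanh (1 * m) - m) (Set.Ici 0) := by
    refine strictAntiOn_of_deriv_neg (convex_Ici 0)
      (fun x _ => (hasDerivAt_tanh_mul_sub 1 x).continuousAt.continuousWithinAt) ?_
    rw [interior_Ici]
    intro y hy
    rw [(hasDerivAt_tanh_mul_sub 1 y).deriv]
    have h1 : 0 < Real.tanh (1 * y) := by
      simpa using strictMono_tanh (show (0 : ℝ) < 1 * y by simpa using hy)
    nlinarith
  have := hanti (a := 0) (b := x) (by simp) hx.le hx
  simp at this
  linarith

theorem existsUnique_isMagnetization (β : ℝ) : ∃! m : ℝ, IsMagnetization β m := by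
  rcases le_or_gt β 1 with h | h
  · refine ⟨0, Or.inl ⟨h, rfl⟩, ?_⟩
    rintro y (⟨-, hy⟩ | ⟨hy, -⟩)
    · exact hy
    · exact absurd hy h.not_gt
  · have hβ : 0 < β := by linarith
    have hex : ∃ m, 0 < m ∧ Real.tanh (β * m) = m := by
      -- The slope of tanh(βm) - m at 0 is β - 1 > 0, so the function is positive at some a < 1; at
      -- 1 it is negative because tanh < 1. A zero lies between.
      have hd := hasDerivAt_tanh_mul_sub β 0
      simp only [mul_zero, Real.tanh_zero, ne_eq, OfNat.ofNat_ne_zero, not_false_eq_true,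
        zero_pow, sub_zero, mul_one] at hd
      rw [hasDerivAt_iff_tendsto_slope] at hd
      have h1 : ∀ᶠ x in 𝓝[>] (0 : ℝ), 0 < slope (fun m => Real.tanh (β * m) - m) 0 x :=
        (hd.mono_left (nhdsWithin_mono _ (by intro x hx; exact ne_of_gt hx))).eventually
          (lt_mem_nhds (show (0 : ℝ) < β - 1 by linarith))
      have h2 : ∀ᶠ x in 𝓝[>] (0 : ℝ), x < 1 := by
        filter_upwards [Ioo_mem_nhdsGT (show (0 : ℝ) < 1 by norm_num)] with x hx using hx.2
      obtain ⟨a, ha, ha1, ha0⟩ := (h1.and (h2.and self_mem_nhdsWithin)).exists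
      have ha0' : 0 < a := ha0
      rw [slope_def_field] at ha
      simp only [mul_zero, Real.tanh_zero, sub_zero] at ha
      have hpos : 0 < Real.tanh (β * a) - a := by
        rcases div_pos_iff.1 ha with h' | h'
        · exact h'.1
        · linarith [h'.2]
      have hcont : ContinuousOn (fun m => Real.tanh (β * m) - m) (Set.Icc a 1) :=
        fun x _ => (hasDerivAt_tanh_mul_sub β x).continuousAt.continuousWithinAt
      have := intermediate_value_Icc' ha1.le hcont
      obtain ⟨m, hm, hm'⟩ := this (show (0 : ℝ) ∈ _ from
        ⟨by have := Real.tanh_lt_one (β * 1); linarith, hpos.le⟩)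
      exact ⟨m, ha0'.trans_le hm.1, by simpa [sub_eq_zero] using hm'⟩
    obtain ⟨m, hm0, hm⟩ := hex
    refine ⟨m, Or.inr ⟨h, hm0, hm⟩, ?_⟩
    rintro y (⟨hy, -⟩ | ⟨-, hy0, hy⟩)
    · exact absurd h hy.not_gt
    · rcases lt_trichotomy y m with h' | h' | h'
      · exact absurd hy (tanh_mul_gt_of_eq hβ hm hy0 h').ne'
      · exact h'
      · exact absurd hm (tanh_mul_gt_of_eq hβ hy hm0 h').ne'

theorem IsMagnetization.sq_lt_one {β m : ℝ} (hm : IsMagnetization β m) : m ^ 2 < 1 := by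
  rcases hm with ⟨-, rfl⟩ | ⟨-, -, h⟩
  · norm_num
  · rw [← h]; exact Real.tanh_sq_lt_one _

/-! ### The mean-field density -/

/-- The function whose `M`-th power is the density of the mixing measure of `M` Curie-Weiss
spins. -/
def mixDensity (β y : ℝ) : ℝ := Real.exp (-(2 * β)⁻¹ * y ^ 2) * Real.cosh y

theorem mixDensity_pos (β y : ℝ) : 0 < mixDensity β y :=
  mul_pos (Real.exp_pos _) (Real.cosh_pos _)

theorem continuous_mixDensity (β : ℝ) : Continuous (mixDensity β) := by
  unfold mixDensity; fun_prop

theorem hasDerivAt_mixDensity (β y : ℝ) : HasDerivAt (mixDensity β)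
    (Real.exp (-(2 * β)⁻¹ * y ^ 2) * Real.cosh y * (Real.tanh y - y / β)) y := by
  have h1 : HasDerivAt (fun y : ℝ => -(2 * β)⁻¹ * y ^ 2) (-(2 * β)⁻¹ * (2 * y)) y := by
    simpa using (hasDerivAt_pow 2 y).const_mul (-(2 * β)⁻¹)
  have h := h1.exp.mul (Real.hasDerivAt_cosh y)
  have hc := (Real.cosh_pos y).ne'
  refine h.congr_deriv ?_
  rw [Real.tanh_eq_sinh_div_cosh]
  rw [mul_inv]
  field_simp
  ring

theorem mixDensity_neg (β y : ℝ) : mixDensity β (-y) = mixDensity β y := by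
  simp [mixDensity]

/-- A critical point satisfies tanh y = y/β, so u = y/β solves the magnetization equation tanh(βu) =
u. By evenness it is enough to treat y ≥ 0. -/
theorem tanh_sq_of_mixDensity_max {β m y₀ : ℝ} (hβ : 0 < β) (hm : IsMagnetization β m)
    (hy : ∀ y, mixDensity β y ≤ mixDensity β y₀) : Real.tanh y₀ ^ 2 = m ^ 2 := by
  wlog h0 : 0 ≤ y₀ generalizing y₀
  · have := this (y₀ := -y₀) (fun y => by rw [mixDensity_neg]; exact hy y) (by linarith)
    simpa using this
  have hloc : IsLocalMax (mixDensity β) y₀ := Eventually.of_forall hy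
  have hd := hloc.hasDerivAt_eq_zero (hasDerivAt_mixDensity β y₀)
  have hcrit : Real.tanh y₀ = y₀ / β := by
    rcases mul_eq_zero.1 hd with h | h
    · exact absurd h (mixDensity_pos β y₀).ne'
    · linarith
  have hmul : ∀ u, β * (u / β) = u := fun u => by field_simp
  rcases h0.eq_or_lt with h0 | h0
  · subst h0
    rcases hm with ⟨-, rfl⟩ | ⟨hβ1, hm0, hm⟩
    · simp
    · exfalso
      -- For β > 1 the origin is critical but not a maximizer: the density strictly increases from 0
      -- up to βm.
      have hmono : StrictMonoOn (mixDensity β) (Set.Icc 0 (β * m)) := by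
        refine strictMonoOn_of_deriv_pos (convex_Icc _ _) (continuous_mixDensity β).continuousOn ?_
        rw [interior_Icc]
        intro y hy
        rw [(hasDerivAt_mixDensity β y).deriv]
        refine mul_pos (mixDensity_pos β y) ?_
        have := tanh_mul_gt_of_eq hβ hm (y := y / β) (div_pos hy.1 hβ)
          (by rw [div_lt_iff₀ hβ]; linarith [hy.2])
        rw [hmul] at this
        linarith
      have hpos : 0 < β * m := by positivity
      have := hmono (a := 0) (b := β * m) ⟨le_rfl, hpos.le⟩ ⟨hpos.le, le_rfl⟩ hpos
      exact absurd (hy (β * m)) this.not_ge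
  · have hu : Real.tanh (β * (y₀ / β)) = y₀ / β := by rw [hmul, hcrit]
    rcases le_or_gt β 1 with h1 | h1
    · have h2 := tanh_lt_self h0
      rw [hcrit, div_lt_iff₀ hβ] at h2
      nlinarith
    · have := (existsUnique_isMagnetization β).unique hm (Or.inr ⟨h1, div_pos h0 hβ, hu⟩)
      rw [this, hcrit]

/-! ### Gaussian integrals and decay of the mixing density. -/

theorem exp_linear_sub_sq (b c y : ℝ) (hb : 0 < b) :
    Real.exp (c * y - b * y ^ 2) =
      Real.exp (c ^ 2 / (4 * b)) * Real.exp (-b * (y - c / (2 * b)) ^ 2) := by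
  rw [← Real.exp_add]
  congr 1
  field_simp
  ring

theorem integrable_exp_linear_sub_sq {b : ℝ} (hb : 0 < b) (c : ℝ) :
    Integrable fun y : ℝ => Real.exp (c * y - b * y ^ 2) := by
  simp_rw [fun y => exp_linear_sub_sq b c y hb]
  exact ((integrable_exp_neg_mul_sq hb).comp_sub_right (c / (2 * b))).const_mul _

theorem integral_exp_linear_sub_sq {b : ℝ} (hb : 0 < b) (c : ℝ) :
    ∫ y : ℝ, Real.exp (c * y - b * y ^ 2) = √(Real.pi / b) * Real.exp (c ^ 2 / (4 * b)) := by
  simp_rw [fun y => exp_linear_sub_sq b c y hb]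
  rw [integral_const_mul, integral_sub_right_eq_self (fun y => Real.exp (-b * y ^ 2)),
    integral_gaussian, mul_comm]

theorem mixDensity_eq (β y : ℝ) : mixDensity β y =
    (Real.exp (1 * y - (2 * β)⁻¹ * y ^ 2) + Real.exp (-1 * y - (2 * β)⁻¹ * y ^ 2)) / 2 := by
  rw [mixDensity, Real.cosh_eq, mul_div_assoc', mul_add, ← Real.exp_add, ← Real.exp_add]
  congr 3 <;> ring

theorem integrable_mixDensity {β : ℝ} (hβ : 0 < β) : Integrable (mixDensity β) := by
  have e : mixDensity β = fun y => _ := funext (mixDensity_eq β)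
  rw [e]
  have hb : 0 < (2 * β)⁻¹ := by positivity
  exact ((integrable_exp_linear_sub_sq hb 1).add (integrable_exp_linear_sub_sq hb (-1))).div_const 2

theorem tendsto_mixDensity_cocompact {β : ℝ} (hβ : 0 < β) :
    Tendsto (mixDensity β) (cocompact ℝ) (𝓝 0) := by
  -- Half of the quadratic term absorbs the linear terms ±y coming from cosh, at the price of the
  -- constant β.
  have hle : ∀ y, mixDensity β y ≤ Real.exp (β - (4 * β)⁻¹ * ‖y‖ ^ 2) := by
    intro y
    have key : ∀ c : ℝ, c ^ 2 = 1 →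
        Real.exp (c * y - (2 * β)⁻¹ * y ^ 2) ≤ Real.exp (β - (4 * β)⁻¹ * ‖y‖ ^ 2) := by
      intro c hc
      rw [Real.exp_le_exp, Real.norm_eq_abs, sq_abs]
      have : β - (4 * β)⁻¹ * y ^ 2 - (c * y - (2 * β)⁻¹ * y ^ 2)
          = (4 * β)⁻¹ * (y - 2 * β * c) ^ 2 + β * (1 - c ^ 2) := by
        field_simp; ring
      have h2 : 0 ≤ (4 * β)⁻¹ * (y - 2 * β * c) ^ 2 := by positivity
      rw [hc] at this
      linarith
    rw [mixDensity_eq]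
    linarith [key 1 (by norm_num), key (-1) (by norm_num)]
  refine squeeze_zero (fun y => (mixDensity_pos β y).le) hle ?_
  refine Real.tendsto_exp_atBot.comp ?_
  refine tendsto_const_nhds.add_atBot (f := fun _ => β) (l := cocompact ℝ) (C := β)
    (g := fun y => -((4 * β)⁻¹ * ‖y‖ ^ 2)) ?_
  refine tendsto_neg_atTop_atBot.comp ?_
  exact ((tendsto_pow_atTop two_ne_zero).comp
    (tendsto_norm_cocompact_atTop (E := ℝ))).const_mul_atTop (by positivity)

/-- Laplace's method: the measures with density proportional to `G ^ M` concentrate on the maxima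
of `G`. -/
theorem tendsto_laplace {G k : ℝ → ℝ} (hG : Continuous G) (hpos : ∀ y, 0 < G y)
    (hint : Integrable G) (hlim : Tendsto G (cocompact ℝ) (𝓝 0)) (hk : Continuous k)
    (hk0 : ∀ y, 0 ≤ k y) {K : ℝ} (hkK : ∀ y, k y ≤ K)
    (hmax : ∀ y₀, (∀ y, G y ≤ G y₀) → k y₀ = 0) :
    Tendsto (fun M : ℕ => (∫ y, k y * G y ^ M) / ∫ y, G y ^ M) atTop (𝓝 0) := by
  have hattain : ∀ C : Set ℝ, IsClosed C → C.Nonempty → ∃ y₀ ∈ C, ∀ y ∈ C, G y ≤ G y₀ := by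
    rintro C hC ⟨c, hc⟩
    refine hG.continuousOn.exists_isMaxOn' hC hc ?_
    exact (hlim.eventually (ge_mem_nhds (hpos c))).filter_mono inf_le_left
  obtain ⟨y₀, -, hy₀⟩ := hattain Set.univ isClosed_univ Set.univ_nonempty
  replace hy₀ : ∀ y, G y ≤ G y₀ := fun y => hy₀ y (Set.mem_univ y)
  -- The exponent is M + 1 because the power 0 is not integrable: M factors are bounded by the
  -- maximum and one is kept for integrability.
  have hpow : ∀ M : ℕ, Integrable fun y => G y ^ (M + 1) := by
    intro M
    have : Integrable fun y => G y ^ M * G y := by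
      refine hint.bdd_mul (c := G y₀ ^ M) (hG.pow M).aestronglyMeasurable ?_
      refine Eventually.of_forall fun y => ?_
      rw [Real.norm_eq_abs, abs_of_nonneg (pow_nonneg (hpos y).le _)]
      exact pow_le_pow_left₀ (hpos y).le (hy₀ y) M
    simpa [pow_succ] using this
  have hK : 0 ≤ K := (hk0 0).trans (hkK 0)
  rw [Metric.tendsto_atTop]
  intro ε hε
  have hC : IsClosed {y | ε / 2 ≤ k y} := isClosed_le continuous_const hk
  -- The closed set where k ≥ ε/2 contains no maximizer, and G attains its supremum there as it
  -- vanishes at infinity; hence the supremum q is strictly below the global maximum.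
  obtain ⟨q, hq0, hqlt, hq⟩ : ∃ q, 0 ≤ q ∧ q < G y₀ ∧ ∀ y, ε / 2 ≤ k y → G y ≤ q := by
    rcases Set.eq_empty_or_nonempty {y | ε / 2 ≤ k y} with he | hne
    · refine ⟨0, le_rfl, hpos y₀, fun y hy => ?_⟩
      have : y ∈ {y | ε / 2 ≤ k y} := hy
      simp [he] at this
    · obtain ⟨y₁, hy₁, h⟩ := hattain _ hC hne
      refine ⟨G y₁, (hpos _).le, ?_, h⟩
      by_contra! hge
      have := hmax y₁ fun y => (hy₀ y).trans hge
      have h2 : ε / 2 ≤ k y₁ := hy₁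
      linarith
  -- On an open set of volume c the density exceeds r > q, so the denominator is at least c r^(M+1),
  -- while the region k ≥ ε/2 contributes O(q^M) to the numerator. The quotient decays like (q/r)^M.
  obtain ⟨r, hqr, hrlt⟩ := exists_between hqlt
  have hr0 : 0 < r := hq0.trans_lt hqr
  have hU : IsOpen {y | r < G y} := isOpen_lt continuous_const hG
  have hUfin : volume {y | r < G y} < ⊤ := by
    have := hint.measure_gt_lt_top hr0
    exact this
  have hUpos : 0 < volume {y | r < G y} := hU.measure_pos _ ⟨y₀, hrlt⟩
  set c := (volume {y | r < G y}).toReal with hc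
  have hc0 : 0 < c := ENNReal.toReal_pos hUpos.ne' hUfin.ne
  have hlow : ∀ M : ℕ, c * r ^ (M + 1) ≤ ∫ y, G y ^ (M + 1) := by
    intro M
    calc c * r ^ (M + 1) = ∫ y in {y | r < G y}, r ^ (M + 1) := by
          rw [setIntegral_const, smul_eq_mul]; rfl
      _ ≤ ∫ y in {y | r < G y}, G y ^ (M + 1) := by
          refine setIntegral_mono_on (by simp [hUfin]) (hpow M).integrableOn hU.measurableSet ?_
          intro y hy
          exact pow_le_pow_left₀ hr0.le (le_of_lt hy) _
      _ ≤ ∫ y, G y ^ (M + 1) :=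
          setIntegral_le_integral (hpow M) (Eventually.of_forall fun y => by
            have := hpos y; positivity)
  have hup : ∀ M : ℕ, ∫ y, k y * G y ^ (M + 1) ≤
      ε / 2 * (∫ y, G y ^ (M + 1)) + K * q ^ M * ∫ y, G y := by
    intro M
    rw [← integral_const_mul, ← integral_const_mul, ← integral_add ((hpow M).const_mul _)
      (hint.const_mul _)]
    refine integral_mono_of_nonneg (Eventually.of_forall fun y => ?_)
      (((hpow M).const_mul _).add (hint.const_mul _)) (Eventually.of_forall fun y => ?_)
    · have := hpos y; have := hk0 y; positivity
    · have := hpos y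
      have h3 : 0 ≤ K * q ^ M * G y := by positivity
      rcases le_or_gt (ε / 2) (k y) with h | h
      · have h1 : k y * G y ^ (M + 1) ≤ K * (q ^ M * G y) := by
          rw [pow_succ]
          have := hq y h
          have := hkK y
          gcongr
        have h2 : 0 ≤ ε / 2 * G y ^ (M + 1) := by positivity
        simp only
        linarith
      · have : k y * G y ^ (M + 1) ≤ ε / 2 * G y ^ (M + 1) := by gcongr
        simp only
        linarith
  have hgeo : Tendsto (fun M : ℕ => K * (∫ y, G y) / (c * r) * (q / r) ^ M) atTop (𝓝 0) := by
    have := (tendsto_pow_atTop_nhds_zero_of_lt_one (r := q / r) (by positivity)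
      (by rw [div_lt_one hr0]; exact hqr)).const_mul (K * (∫ y, G y) / (c * r))
    simpa using this
  obtain ⟨M₀, hM₀⟩ := (hgeo.eventually (gt_mem_nhds (show (0 : ℝ) < ε / 2 by linarith))).exists_forall_of_atTop
  refine ⟨M₀ + 1, fun M hM => ?_⟩
  obtain ⟨L, rfl⟩ : ∃ L, M = L + 1 := ⟨M - 1, by omega⟩
  have hLpos : 0 < ∫ y, G y ^ (L + 1) := lt_of_lt_of_le (by positivity) (hlow L)
  have hnn : 0 ≤ ∫ y, k y * G y ^ (L + 1) := integral_nonneg fun y => by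
    have := hpos y; have := hk0 y; simp only [Pi.zero_apply]; positivity
  rw [Real.dist_eq, sub_zero, abs_of_nonneg (by positivity), div_lt_iff₀ hLpos]
  refine (hup L).trans_lt ?_
  have h1 := hM₀ L (by omega)
  have h2 : K * q ^ L * ∫ y, G y = K * (∫ y, G y) / (c * r) * (q / r) ^ L * (c * r ^ (L + 1)) := by
    rw [div_pow]
    field_simp
    ring
  rw [h2]
  have h3 : K * (∫ y, G y) / (c * r) * (q / r) ^ L * (c * r ^ (L + 1)) < ε / 2 * (c * r ^ (L + 1)) :=
    mul_lt_mul_of_pos_right h1 (by positivity)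
  have h4 := mul_le_mul_of_nonneg_left (hlow L) (show 0 ≤ ε / 2 by linarith)
  linarith

/-! ### The resolvent of a real symmetric matrix -/

section Green

variable {n : Type*} [Fintype n] [DecidableEq n] {M : Matrix n n ℝ}

/-- The resolvent `(M - z)⁻¹` of a real symmetric matrix `M`, given by its spectral decomposition. -/
def green (hM : M.IsHermitian) (z : ℂ) : Matrix n n ℂ :=
  Matrix.of fun i j => ∑ k, (hM.eigenvectorBasis k i : ℂ) * (hM.eigenvectorBasis k j : ℂ) *
    ((hM.eigenvalues k : ℂ) - z)⁻¹

theorem green_apply (hM : M.IsHermitian) (z : ℂ) (i j : n) :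
    green hM z i j = ∑ k, (hM.eigenvectorBasis k i : ℂ) * (hM.eigenvectorBasis k j : ℂ) *
    ((hM.eigenvalues k : ℂ) - z)⁻¹ := rfl

theorem green_symm (hM : M.IsHermitian) (z : ℂ) (i j : n) :
    green hM z i j = green hM z j i := by
  simp only [green_apply]
  exact Finset.sum_congr rfl fun k _ => by ring

theorem ofReal_sub_ne_zero {z : ℂ} (hz : 0 < z.im) (x : ℝ) : (x : ℂ) - z ≠ 0 := by
  intro h
  have := congrArg Complex.im h
  simp at this
  linarith

theorem norm_inv_ofReal_sub_le {z : ℂ} (hz : 0 < z.im) (x : ℝ) :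
    ‖((x : ℂ) - z)⁻¹‖ ≤ z.im⁻¹ := by
  rw [norm_inv]
  refine inv_anti₀ hz ?_
  have := Complex.abs_im_le_norm ((x : ℂ) - z)
  simp only [Complex.sub_im, Complex.ofReal_im, zero_sub, abs_neg, abs_of_pos hz] at this
  exact this

theorem sum_eigenvectorBasis_mul (hM : M.IsHermitian) (i j : n) :
    ∑ k, hM.eigenvectorBasis k i * hM.eigenvectorBasis k j = if i = j then 1 else 0 := by
  have h := (Matrix.mem_unitaryGroup_iff).1 (hM.eigenvectorUnitary).2
  have h2 := congrFun (congrFun h i) j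
  rw [Matrix.mul_apply, Matrix.one_apply] at h2
  rw [← h2]
  exact Finset.sum_congr rfl fun k _ => by
    rw [Matrix.star_apply, Matrix.IsHermitian.eigenvectorUnitary_apply,
      Matrix.IsHermitian.eigenvectorUnitary_apply, star_trivial]

theorem sum_eigenvectorBasis_mul_self (hM : M.IsHermitian) (k : n) :
    ∑ i, hM.eigenvectorBasis k i * hM.eigenvectorBasis k i = 1 := by
  have h := (Matrix.mem_unitaryGroup_iff').1 (hM.eigenvectorUnitary).2
  have h2 := congrFun (congrFun h k) k
  rw [Matrix.mul_apply, Matrix.one_apply_eq] at h2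
  rw [← h2]
  exact Finset.sum_congr rfl fun k _ => by
    rw [Matrix.star_apply, Matrix.IsHermitian.eigenvectorUnitary_apply, star_trivial]

theorem sum_mul_eigenvectorBasis (hM : M.IsHermitian) (i k : n) :
    ∑ j, M i j * hM.eigenvectorBasis k j = hM.eigenvalues k * hM.eigenvectorBasis k i := by
  simpa [Matrix.mulVec, dotProduct] using congrFun (hM.mulVec_eigenvectorBasis k) i

theorem trace_green (hM : M.IsHermitian) (z : ℂ) :
    ∑ i, green hM z i i = ∑ k, ((hM.eigenvalues k : ℂ) - z)⁻¹ := by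
  simp only [green_apply]
  rw [Finset.sum_comm]
  refine Finset.sum_congr rfl fun k _ => ?_
  rw [← Finset.sum_mul]
  have := congrArg (fun r : ℝ => (r : ℂ)) (sum_eigenvectorBasis_mul_self hM k)
  push_cast at this
  rw [this, one_mul]

theorem map_mul_green (hM : M.IsHermitian) {z : ℂ} (hz : 0 < z.im) :
    M.map (fun r : ℝ => (r : ℂ)) * green hM z = 1 + z • green hM z := by
  ext i l
  simp only [Matrix.mul_apply, Matrix.map_apply, green_apply, Matrix.add_apply, Matrix.smul_apply,
    smul_eq_mul, Finset.mul_sum]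
  rw [Finset.sum_comm]
  have h1 : (1 : Matrix n n ℂ) i l = ∑ k, (hM.eigenvectorBasis k i : ℂ) * hM.eigenvectorBasis k l := by
    have := congrArg (fun r : ℝ => (r : ℂ)) (sum_eigenvectorBasis_mul hM i l)
    push_cast at this
    rw [this, Matrix.one_apply]; split_ifs <;> simp
  rw [h1, ← Finset.sum_add_distrib]
  refine Finset.sum_congr rfl fun k _ => ?_
  have h2 := congrArg (fun r : ℝ => (r : ℂ)) (sum_mul_eigenvectorBasis hM i k)
  push_cast at h2
  calc ∑ j, (M i j : ℂ) * ((hM.eigenvectorBasis k j : ℂ) * (hM.eigenvectorBasis k l : ℂ) *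
        ((hM.eigenvalues k : ℂ) - z)⁻¹)
      = (∑ j, (M i j : ℂ) * (hM.eigenvectorBasis k j : ℂ)) * ((hM.eigenvectorBasis k l : ℂ) *
        ((hM.eigenvalues k : ℂ) - z)⁻¹) := by
        rw [Finset.sum_mul]; exact Finset.sum_congr rfl fun j _ => by ring
    _ = _ := by
        rw [h2]
        have := ofReal_sub_ne_zero hz (hM.eigenvalues k)
        field_simp
        ring

theorem green_transpose (hM : M.IsHermitian) (z : ℂ) : (green hM z).transpose = green hM z := by
  ext i j; exact green_symm hM z j i

theorem green_mul_map (hM : M.IsHermitian) {z : ℂ} (hz : 0 < z.im) :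
    green hM z * M.map (fun r : ℝ => (r : ℂ)) = 1 + z • green hM z := by
  have h := congrArg Matrix.transpose (map_mul_green hM hz)
  rw [Matrix.transpose_mul, Matrix.transpose_add, Matrix.transpose_smul, green_transpose,
    Matrix.transpose_one] at h
  rw [← h]
  congr 1
  ext i j
  have := congrFun (congrFun hM i) j
  simp only [Matrix.conjTranspose_apply, star_trivial] at this
  simp [this]

/-- The resolvent identity; it makes the effect of a single spin flip exact. -/
theorem green_sub_green {M' : Matrix n n ℝ} (hM : M.IsHermitian) (hM' : M'.IsHermitian) {z : ℂ}
    (hz : 0 < z.im) :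
    green hM z - green hM' z =
      green hM z * (M' - M).map (fun r : ℝ => (r : ℂ)) * green hM' z := by
  have e : (M' - M).map (fun r : ℝ => (r : ℂ)) =
      M'.map (fun r : ℝ => (r : ℂ)) - M.map (fun r : ℝ => (r : ℂ)) := by
    ext i j; simp
  rw [e, mul_sub, sub_mul, mul_assoc, map_mul_green hM' hz, green_mul_map hM hz, mul_add, add_mul,
    mul_one, one_mul, Matrix.mul_smul, Matrix.smul_mul]
  abel

theorem sum_norm_sq_coeff (hM : M.IsHermitian) (a : n → ℂ) :
    ∑ k, ‖∑ i, a i * (hM.eigenvectorBasis k i : ℂ)‖ ^ 2 = ∑ i, ‖a i‖ ^ 2 := by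
  have key : (∑ k, (∑ i, a i * (hM.eigenvectorBasis k i : ℂ)) *
      (starRingEnd ℂ) (∑ i, a i * (hM.eigenvectorBasis k i : ℂ))) = ∑ i, a i * starRingEnd ℂ (a i) := by
    simp only [map_sum, map_mul, Complex.conj_ofReal, Finset.sum_mul_sum]
    rw [Finset.sum_comm]
    refine Finset.sum_congr rfl fun i _ => ?_
    rw [Finset.sum_comm]
    have : ∀ j, ∑ k, a i * (hM.eigenvectorBasis k i : ℂ) *
        (starRingEnd ℂ (a j) * (hM.eigenvectorBasis k j : ℂ)) =
        if i = j then a i * starRingEnd ℂ (a j) else 0 := by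
      intro j
      have h := congrArg (fun r : ℝ => (r : ℂ)) (sum_eigenvectorBasis_mul hM i j)
      push_cast at h
      calc _ = a i * starRingEnd ℂ (a j) *
            ∑ k, (hM.eigenvectorBasis k i : ℂ) * (hM.eigenvectorBasis k j : ℂ) := by
            rw [Finset.mul_sum]; exact Finset.sum_congr rfl fun k _ => by ring
        _ = _ := by rw [h]; split_ifs <;> simp
    simp [this]
  simp only [Complex.mul_conj, Complex.normSq_eq_norm_sq] at key
  exact_mod_cast key

/-- This is the operator norm bound 1/Im z in bilinear form: expand in the eigenbasis, bound each
1/(λ - z), then use Cauchy–Schwarz and Parseval. Every later resolvent bound is a choice of a and b.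
-/
theorem norm_bilin_green_le (hM : M.IsHermitian) {z : ℂ} (hz : 0 < z.im) (a b : n → ℂ) :
    ‖∑ i, ∑ j, a i * green hM z i j * b j‖ ≤
      z.im⁻¹ * (√(∑ i, ‖a i‖ ^ 2) * √(∑ i, ‖b i‖ ^ 2)) := by
  have e : ∑ i, ∑ j, a i * green hM z i j * b j =
      ∑ k, (∑ i, a i * (hM.eigenvectorBasis k i : ℂ)) * (∑ j, b j * (hM.eigenvectorBasis k j : ℂ)) *
        ((hM.eigenvalues k : ℂ) - z)⁻¹ := by
    simp only [green_apply, Finset.mul_sum, Finset.sum_mul]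
    rw [Finset.sum_congr rfl fun i _ => Finset.sum_comm, Finset.sum_comm]
    refine Finset.sum_congr rfl fun k _ => ?_
    rw [Finset.sum_comm]
    exact Finset.sum_congr rfl fun i _ => Finset.sum_congr rfl fun j _ => by ring
  rw [e, ← sum_norm_sq_coeff hM a, ← sum_norm_sq_coeff hM b]
  refine (norm_sum_le _ _).trans ?_
  refine le_trans ?_ (mul_le_mul_of_nonneg_left (Real.sum_mul_le_sqrt_mul_sqrt _ _ _) (by positivity))
  rw [Finset.mul_sum]
  refine Finset.sum_le_sum fun k _ => ?_
  rw [norm_mul, norm_mul, mul_comm]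
  exact mul_le_mul_of_nonneg_right (norm_inv_ofReal_sub_le hz _) (by positivity)

theorem norm_green_le (hM : M.IsHermitian) {z : ℂ} (hz : 0 < z.im) (i j : n) :
    ‖green hM z i j‖ ≤ z.im⁻¹ := by
  have h := norm_bilin_green_le hM hz (Pi.single i 1) (Pi.single j 1)
  simpa [Pi.single_apply, ite_pow, apply_ite] using h

/-- The all-ones vector has squared norm N, so N² entries sum to only O(N). This makes the nonzero
mean of the spins harmless. -/
theorem norm_sum_green_le (hM : M.IsHermitian) {z : ℂ} (hz : 0 < z.im) :
    ‖∑ i, ∑ j, green hM z i j‖ ≤ z.im⁻¹ * Fintype.card n := by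
  have h := norm_bilin_green_le hM hz (fun _ => 1) (fun _ => 1)
  simpa using h

/-- Testing the bilinear bound against the conjugate of the row gives S ≤ (Im z)⁻¹ √S for the sum S.
-/
theorem sum_norm_sq_green_le (hM : M.IsHermitian) {z : ℂ} (hz : 0 < z.im) (i : n) :
    ∑ j, ‖green hM z i j‖ ^ 2 ≤ z.im⁻¹ ^ 2 := by
  have h := norm_bilin_green_le hM hz (Pi.single i 1) (fun j => starRingEnd ℂ (green hM z i j))
  have e : ∑ i', ∑ j, (Pi.single i 1 : n → ℂ) i' * green hM z i' j * starRingEnd ℂ (green hM z i j) =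
      ((∑ j, ‖green hM z i j‖ ^ 2 : ℝ) : ℂ) := by
    rw [Finset.sum_eq_single i]
    · simp [Complex.mul_conj, Complex.normSq_eq_norm_sq]
    · intro b _ hb; simp [hb]
    · simp
  rw [e, Complex.norm_real, Real.norm_eq_abs, abs_of_nonneg (by positivity)] at h
  have e2 : √(∑ i', ‖(Pi.single i 1 : n → ℂ) i'‖ ^ 2) = 1 := by
    simp [Pi.single_apply, ite_pow, apply_ite]
  rw [e2, one_mul] at h
  simp only [RCLike.norm_conj] at h
  set S := ∑ j, ‖green hM z i j‖ ^ 2 with hS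
  have hS0 : 0 ≤ S := by positivity
  have h3 : √S ≤ z.im⁻¹ := by
    rcases hS0.eq_or_lt with h0 | h0
    · rw [← h0]; simp [hz.le]
    · have : √S * √S ≤ z.im⁻¹ * √S := by rwa [Real.mul_self_sqrt hS0]
      exact le_of_mul_le_mul_right this (Real.sqrt_pos.2 h0)
  calc S = √S ^ 2 := (Real.sq_sqrt hS0).symm
    _ ≤ _ := by gcongr

end Green

/-! ### Independent spins -/

section Spins

variable {ι : Type*}

/-- The configuration `x` as a real-valued function. -/
def spin (x : ι → ℤˣ) (i : ι) : ℝ := ((x i : ℤ) : ℝ)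

theorem spin_eq_or (x : ι → ℤˣ) (i : ι) : spin x i = 1 ∨ spin x i = -1 := by
  rcases Int.units_eq_one_or (x i) with h | h <;> simp [spin, h]

theorem abs_spin (x : ι → ℤˣ) (i : ι) : |spin x i| = 1 := by
  rcases spin_eq_or x i with h | h <;> simp [h]

theorem spin_mul_self (x : ι → ℤˣ) (i : ι) : spin x i * spin x i = 1 := by
  rcases spin_eq_or x i with h | h <;> simp [h]

/-- The probability of `x` if the spins are independent with mean `t`. -/
def prodWeight [Fintype ι] (t : ℝ) (x : ι → ℤˣ) : ℝ := ∏ i, (1 + t * spin x i) / 2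

theorem prodWeight_nonneg [Fintype ι] {t : ℝ} (ht : |t| ≤ 1) (x : ι → ℤˣ) : 0 ≤ prodWeight t x := by
  refine Finset.prod_nonneg fun i _ => ?_
  have := abs_le.1 ht
  rcases spin_eq_or x i with h | h <;> rw [h] <;> linarith [this.1, this.2]

variable [DecidableEq ι]

/-- The configuration `x` with the sign of the spin `i` reversed. -/
def flip (i : ι) (x : ι → ℤˣ) : ι → ℤˣ := Function.update x i (-x i)

theorem flip_flip (i : ι) (x : ι → ℤˣ) : flip i (flip i x) = x := by
  simp [flip]

theorem spin_flip_self (i : ι) (x : ι → ℤˣ) : spin (flip i x) i = -spin x i := by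
  simp [spin, flip]

theorem spin_flip_of_ne {i j : ι} (h : j ≠ i) (x : ι → ℤˣ) : spin (flip i x) j = spin x j := by
  simp [spin, flip, h]

theorem sum_units {E : Type*} [AddCommMonoid E] (f : ℤˣ → E) : ∑ e, f e = f 1 + f (-1) := by
  rw [show (Finset.univ : Finset ℤˣ) = {1, -1} from rfl, Finset.sum_pair (by decide)]

variable [Fintype ι]

theorem sum_flip {E : Type*} [AddCommMonoid E] (i : ι) (g : (ι → ℤˣ) → E) :
    ∑ x, g (flip i x) = ∑ x, g x :=
  Equiv.sum_comp (Function.Involutive.toPerm (flip i) (flip_flip i)) g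

theorem sum_prodWeight (t : ℝ) : ∑ x : ι → ℤˣ, prodWeight t x = 1 := by
  have h := Finset.prod_univ_sum (fun _ : ι => (Finset.univ : Finset ℤˣ))
    (fun _ e => (1 + t * ((e : ℤ) : ℝ)) / 2)
  rw [Fintype.piFinset_univ] at h
  unfold prodWeight spin
  rw [← h]
  refine Finset.prod_eq_one fun i _ => ?_
  rw [sum_units]
  push_cast
  ring

/-- The discrete derivative of `g` with respect to the spin `i`. -/
def spinDeriv (i : ι) (g : (ι → ℤˣ) → ℂ) (x : ι → ℤˣ) : ℂ :=
  (spin x i : ℂ) / 2 * (g x - g (flip i x))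

theorem prodWeight_eq (t : ℝ) (i : ι) (x : ι → ℤˣ) : prodWeight t x =
    (1 + t * spin x i) / 2 * ∏ j ∈ Finset.univ.erase i, (1 + t * spin x j) / 2 :=
  (Finset.mul_prod_erase _ _ (Finset.mem_univ i)).symm

theorem prodWeight_flip (t : ℝ) (i : ι) (x : ι → ℤˣ) : prodWeight t (flip i x) =
    (1 - t * spin x i) / 2 * ∏ j ∈ Finset.univ.erase i, (1 + t * spin x j) / 2 := by
  rw [prodWeight_eq t i, spin_flip_self, mul_neg, ← sub_eq_add_neg]
  congr 1
  exact Finset.prod_congr rfl fun j hj => by rw [spin_flip_of_ne (Finset.ne_of_mem_erase hj)]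

/-- Integration by parts for independent spins. -/
theorem sum_prodWeight_mul_spin_sub (t : ℝ) (i : ι) (g : (ι → ℤˣ) → ℂ) :
    ∑ x, (prodWeight t x : ℂ) * (((spin x i : ℂ) - t) * g x) =
      (1 - t ^ 2) * ∑ x, (prodWeight t x : ℂ) * spinDeriv i g x := by
  have h1 : ∑ x, (prodWeight t x : ℂ) * spinDeriv i g x =
      ∑ x, (((prodWeight t x + prodWeight t (flip i x)) * spin x i / 2 : ℝ) : ℂ) * g x := by
    have e : ∀ x, (prodWeight t x : ℂ) * spinDeriv i g x =
        (prodWeight t x : ℂ) * spin x i / 2 * g x - (prodWeight t x : ℂ) * spin x i / 2 * g (flip i x) := by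
      intro x; rw [spinDeriv]; ring
    simp only [e, Finset.sum_sub_distrib]
    rw [← sum_flip i (fun x => (prodWeight t x : ℂ) * spin x i / 2 * g (flip i x)),
      ← Finset.sum_sub_distrib]
    refine Finset.sum_congr rfl fun x _ => ?_
    rw [flip_flip, spin_flip_self]
    push_cast
    ring
  rw [h1, Finset.mul_sum]
  refine Finset.sum_congr rfl fun x _ => ?_
  -- The two weights add up to the product over the other spins, and (1 + ts)(s - t) = (1 - t²)s
  -- since s² = 1. Two-valued spins therefore satisfy the formula with no error term.
  have h2 : prodWeight t x * (spin x i - t) =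
      (1 - t ^ 2) * ((prodWeight t x + prodWeight t (flip i x)) * spin x i / 2) := by
    rw [prodWeight_flip, prodWeight_eq t i]
    have := spin_mul_self x i
    linear_combination (∏ j ∈ Finset.univ.erase i, (1 + t * spin x j) / 2) * t / 2 * this
  have h3 := congrArg (fun r : ℝ => (r : ℂ)) h2
  push_cast at h3 ⊢
  linear_combination g x * h3

end Spins

/-! ### The self-consistent equation -/

section SelfConsistent

variable {N : ℕ}

/-- The index on or above the diagonal that determines the entry `(i, j)`. -/
def upperIndex (i j : Fin N) : Fin N × Fin N := if i ≤ j then (i, j) else (j, i)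

theorem symmFill_apply (x : Fin N × Fin N → ℝ) (i j : Fin N) :
    symmFill x i j = x (upperIndex i j) := by
  rw [symmFill, upperIndex, Matrix.of_apply]
  split_ifs <;> rfl

theorem upperIndex_eq_iff (a b i j : Fin N) :
    upperIndex a b = upperIndex i j ↔ (a = i ∧ b = j) ∨ (a = j ∧ b = i) := by
  unfold upperIndex
  split_ifs <;> simp only [Prod.mk.injEq] <;> grind

theorem normalizedMatrix_apply (x : Fin N × Fin N → ℝ) (i j : Fin N) :
    normalizedMatrix x i j = (√(N : ℝ))⁻¹ * x (upperIndex i j) := by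
  rw [normalizedMatrix, Matrix.smul_apply, symmFill_apply, smul_eq_mul, one_div]

/-- The resolvent of the normalized matrix of the configuration `x`. -/
def spinGreen (z : ℂ) (x : Fin N × Fin N → ℤˣ) : Matrix (Fin N) (Fin N) ℂ :=
  green (normalizedMatrix_isHermitian (spin x)) z

/-- The Stieltjes transform of the eigenvalue distribution of the configuration `x`. -/
def spinStieltjes (z : ℂ) (x : Fin N × Fin N → ℤˣ) : ℂ :=
  (N : ℂ)⁻¹ * ∑ i, spinGreen z x i i

/-- The defect in the self-consistent equation for the Stieltjes transform. -/
def defect (z : ℂ) (t : ℝ) (x : Fin N × Fin N → ℤˣ) : ℂ :=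
  1 + z * spinStieltjes z x + (1 - (t : ℂ) ^ 2) * spinStieltjes z x ^ 2


/-! ### A priori bounds and the effect of one spin flip. -/

theorem norm_spinStieltjes_le {z : ℂ} (hz : 0 < z.im) (x : Fin N × Fin N → ℤˣ) : ‖spinStieltjes z x‖ ≤ z.im⁻¹ := by
  rw [spinStieltjes, norm_mul, norm_inv, Complex.norm_natCast]
  have h : ‖∑ i, spinGreen z x i i‖ ≤ N * z.im⁻¹ := by
    refine (norm_sum_le _ _).trans ?_
    refine (Finset.sum_le_sum fun i _ => norm_green_le _ hz i i).trans ?_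
    simp
  rcases N.eq_zero_or_pos with h0 | h0
  · subst h0; simp [hz.le]
  · rw [inv_mul_le_iff₀ (by positivity)]
    exact h

theorem norm_one_sub_sq_le {t : ℝ} (ht : |t| ≤ 1) : ‖(1 : ℂ) - (t : ℂ) ^ 2‖ ≤ 1 := by
  rw [show (1 : ℂ) - (t : ℂ) ^ 2 = ((1 - t ^ 2 : ℝ) : ℂ) by push_cast; ring, Complex.norm_real,
    Real.norm_eq_abs, abs_le]
  have := (sq_le_one_iff_abs_le_one t).2 ht
  constructor <;> nlinarith

theorem norm_defect_le {z : ℂ} (hz : 0 < z.im) {t : ℝ} (ht : |t| ≤ 1) (x : Fin N × Fin N → ℤˣ) :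
    ‖defect z t x‖ ≤ 1 + ‖z‖ * z.im⁻¹ + z.im⁻¹ ^ 2 := by
  have hs := norm_spinStieltjes_le hz x
  have hv := norm_one_sub_sq_le ht
  have hi : 0 < z.im⁻¹ := inv_pos.2 hz
  refine (norm_add₃_le).trans ?_
  rw [norm_one, norm_mul, norm_mul, norm_pow]
  have : ‖1 - (t : ℂ) ^ 2‖ * ‖spinStieltjes z x‖ ^ 2 ≤ 1 * z.im⁻¹ ^ 2 := by gcongr
  have : ‖z‖ * ‖spinStieltjes z x‖ ≤ ‖z‖ * z.im⁻¹ := by gcongr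
  linarith

/-- A flip changes the matrix only at (i, j) and (j, i), each by -2 spin/√N; the resolvent identity
then gives two rank-one terms. The indicator keeps a diagonal entry from being counted twice. -/
theorem spinGreen_sub_flip {z : ℂ} (hz : 0 < z.im) (x : Fin N × Fin N → ℤˣ) (i j k l : Fin N) :
    spinGreen z x k l - spinGreen z (flip (upperIndex i j) x) k l =
      -2 * ((√(N : ℝ))⁻¹ : ℝ) * spin x (upperIndex i j) *
      (spinGreen z x k i * spinGreen z (flip (upperIndex i j) x) j l +
        (if i = j then 0 else 1) *
          (spinGreen z x k j * spinGreen z (flip (upperIndex i j) x) i l)) := by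
  set x' := flip (upperIndex i j) x with hx'
  have h := green_sub_green (normalizedMatrix_isHermitian (spin x))
    (normalizedMatrix_isHermitian (spin x')) hz
  have e : (normalizedMatrix (spin x') - normalizedMatrix (spin x)).map (fun r : ℝ => (r : ℂ)) =
      (-2 * ((√(N : ℝ))⁻¹ : ℝ) * spin x (upperIndex i j) : ℂ) •
        (Matrix.single i j (1 : ℂ) + (if i = j then (0 : ℂ) else 1) • Matrix.single j i (1 : ℂ)) := by
    ext a b
    simp only [Matrix.map_apply, Matrix.sub_apply, normalizedMatrix_apply, Matrix.smul_apply,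
      Matrix.add_apply, Matrix.single_apply, smul_eq_mul]
    by_cases hab : upperIndex a b = upperIndex i j
    · rw [hab, hx', spin_flip_self]
      have e2 : ((if i = a ∧ j = b then (1 : ℂ) else 0) +
          (if i = j then (0 : ℂ) else 1) * if j = a ∧ i = b then (1 : ℂ) else 0) = 1 := by
        rw [upperIndex_eq_iff] at hab
        by_cases hij : i = j
        · rw [if_pos hij, if_pos (by grind)]; ring
        · rw [if_neg hij]
          rcases hab with h' | h'
          · rw [if_pos (by grind), if_neg (by grind)]; ring
          · rw [if_neg (by grind), if_pos (by grind)]; ring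
      rw [e2]
      push_cast
      ring
    · rw [hx', spin_flip_of_ne hab]
      rw [upperIndex_eq_iff] at hab
      rw [if_neg (show ¬(i = a ∧ j = b) from fun h' => hab (Or.inl ⟨h'.1.symm, h'.2.symm⟩)),
        if_neg (show ¬(j = a ∧ i = b) from fun h' => hab (Or.inr ⟨h'.1.symm, h'.2.symm⟩))]
      simp
  have h2 := congrFun (congrFun h k) l
  rw [e] at h2
  have s1 : ∀ (A B : Matrix (Fin N) (Fin N) ℂ) (a b : Fin N),
      (A * Matrix.single a b (1 : ℂ) * B) k l = A k a * B b l := by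
    intro A B a b
    rw [Matrix.mul_apply, Finset.sum_eq_single b]
    · simp
    · intro c _ hc; rw [Matrix.mul_single_apply_of_ne _ _ _ _ _ hc, zero_mul]
    · simp
  rw [Matrix.mul_smul, Matrix.smul_mul, mul_add, add_mul, Matrix.mul_smul, Matrix.smul_mul,
    Matrix.smul_apply, Matrix.add_apply, Matrix.smul_apply, s1, s1] at h2
  exact h2

theorem norm_spinGreen_le {z : ℂ} (hz : 0 < z.im) (x : Fin N × Fin N → ℤˣ) (i j : Fin N) :
    ‖spinGreen z x i j‖ ≤ z.im⁻¹ := norm_green_le _ hz i j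

theorem norm_neg_two_mul (x : Fin N × Fin N → ℤˣ) (p : Fin N × Fin N) :
    ‖(-2 * ((√(N : ℝ))⁻¹ : ℝ) * spin x p : ℂ)‖ = 2 * (√(N : ℝ))⁻¹ := by
  rw [norm_mul, norm_mul, Complex.norm_real, Complex.norm_real, Real.norm_eq_abs, Real.norm_eq_abs,
    abs_spin, abs_of_nonneg (by positivity)]
  simp

theorem norm_spinGreen_sub_flip_le {z : ℂ} (hz : 0 < z.im) (x : Fin N × Fin N → ℤˣ) (i j k l : Fin N) :
    ‖spinGreen z x k l - spinGreen z (flip (upperIndex i j) x) k l‖ ≤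
      4 * (√(N : ℝ))⁻¹ * z.im⁻¹ ^ 2 := by
  rw [spinGreen_sub_flip hz, norm_mul, norm_neg_two_mul]
  have hi : 0 < z.im⁻¹ := inv_pos.2 hz
  have hb : ∀ (a b c d : Fin N), ‖spinGreen z x a b * spinGreen z (flip (upperIndex i j) x) c d‖ ≤
      z.im⁻¹ ^ 2 := by
    intro a b c d
    rw [norm_mul, sq]
    exact mul_le_mul (norm_spinGreen_le hz _ _ _) (norm_spinGreen_le hz _ _ _) (norm_nonneg _) hi.le
  have : ‖spinGreen z x k i * spinGreen z (flip (upperIndex i j) x) j l +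
        (if i = j then 0 else 1) *
          (spinGreen z x k j * spinGreen z (flip (upperIndex i j) x) i l)‖ ≤ 2 * z.im⁻¹ ^ 2 := by
    refine (norm_add_le _ _).trans ?_
    have h1 := hb k i j l
    have h2 := hb k j i l
    split_ifs
    · simp only [zero_mul, norm_zero, add_zero]
      nlinarith [sq_nonneg z.im⁻¹]
    · rw [one_mul]; linarith
  calc _ ≤ 2 * (√(N : ℝ))⁻¹ * (2 * z.im⁻¹ ^ 2) := by gcongr
    _ = _ := by ring

/-- Cauchy–Schwarz and the row bound `sum_norm_sq_green_le` keep the trace of the difference at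
O(N^(-1/2)); with the prefactor 1/N, a flip moves the Stieltjes transform by O(N^(-3/2)). -/
theorem norm_spinStieltjes_sub_flip_le {z : ℂ} (hz : 0 < z.im) (x : Fin N × Fin N → ℤˣ) (i j : Fin N) :
    ‖spinStieltjes z x - spinStieltjes z (flip (upperIndex i j) x)‖ ≤
      4 * (√(N : ℝ))⁻¹ * z.im⁻¹ ^ 2 * (N : ℝ)⁻¹ := by
  have hi : 0 < z.im⁻¹ := inv_pos.2 hz
  rw [spinStieltjes, spinStieltjes, ← mul_sub, ← Finset.sum_sub_distrib]
  simp only [spinGreen_sub_flip hz]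
  rw [← Finset.mul_sum, norm_mul, norm_mul, norm_neg_two_mul, norm_inv, Complex.norm_natCast]
  set x' := flip (upperIndex i j) x
  have hb : ∀ a b : Fin N, ‖∑ k, spinGreen z x k a * spinGreen z x' b k‖ ≤ z.im⁻¹ ^ 2 := by
    intro a b
    refine (norm_sum_le _ _).trans ?_
    simp only [norm_mul]
    refine (Real.sum_mul_le_sqrt_mul_sqrt _ _ _).trans ?_
    have h1 : √(∑ k, ‖spinGreen z x k a‖ ^ 2) ≤ z.im⁻¹ := by
      refine Real.sqrt_le_iff.2 ⟨hi.le, ?_⟩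
      refine le_of_eq_of_le (Finset.sum_congr rfl fun k _ => ?_)
        (sum_norm_sq_green_le (normalizedMatrix_isHermitian (spin x)) hz a)
      rw [spinGreen, green_symm]
    have h2 : √(∑ k, ‖spinGreen z x' b k‖ ^ 2) ≤ z.im⁻¹ :=
      Real.sqrt_le_iff.2 ⟨hi.le, sum_norm_sq_green_le _ hz b⟩
    rw [sq]
    exact mul_le_mul h1 h2 (Real.sqrt_nonneg _) hi.le
  have : ‖∑ k, (spinGreen z x k i * spinGreen z x' j k +
        (if i = j then 0 else 1) * (spinGreen z x k j * spinGreen z x' i k))‖ ≤ 2 * z.im⁻¹ ^ 2 := by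
    rw [Finset.sum_add_distrib, ← Finset.mul_sum]
    refine (norm_add_le _ _).trans ?_
    have h1 := hb i j
    have h2 := hb j i
    split_ifs
    · simp only [zero_mul, norm_zero, add_zero]
      nlinarith [sq_nonneg z.im⁻¹]
    · rw [one_mul]; linarith
  calc _ ≤ (N : ℝ)⁻¹ * (2 * (√(N : ℝ))⁻¹ * (2 * z.im⁻¹ ^ 2)) := by gcongr
    _ = _ := by ring

theorem norm_defect_sub_flip_le {z : ℂ} (hz : 0 < z.im) {t : ℝ} (ht : |t| ≤ 1) (x : Fin N × Fin N → ℤˣ) (i j : Fin N) :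
    ‖defect z t x - defect z t (flip (upperIndex i j) x)‖ ≤
      (‖z‖ + 2 * z.im⁻¹) * (4 * (√(N : ℝ))⁻¹ * z.im⁻¹ ^ 2 * (N : ℝ)⁻¹) := by
  set x' := flip (upperIndex i j) x
  have hi : 0 < z.im⁻¹ := inv_pos.2 hz
  have e : defect z t x - defect z t x' = (z + (1 - (t : ℂ) ^ 2) *
      (spinStieltjes z x + spinStieltjes z x')) * (spinStieltjes z x - spinStieltjes z x') := by
    rw [defect, defect]; ring
  rw [e, norm_mul]
  refine mul_le_mul ?_ (norm_spinStieltjes_sub_flip_le hz x i j) (norm_nonneg _) (by positivity)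
  refine (norm_add_le _ _).trans ?_
  rw [norm_mul]
  have h1 : ‖spinStieltjes z x + spinStieltjes z x'‖ ≤ 2 * z.im⁻¹ := by
    refine (norm_add_le _ _).trans ?_
    linarith [norm_spinStieltjes_le hz x, norm_spinStieltjes_le hz x']
  have : ‖(1 : ℂ) - (t : ℂ) ^ 2‖ * ‖spinStieltjes z x + spinStieltjes z x'‖ ≤ 1 * (2 * z.im⁻¹) :=
    mul_le_mul (norm_one_sub_sq_le ht) h1 (norm_nonneg _) zero_le_one
  linarith

/-- The discrete derivative of an entry of the resolvent is, to leading order, the derivative. -/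
theorem norm_spinDeriv_spinGreen_add_le {z : ℂ} (hz : 0 < z.im) (x : Fin N × Fin N → ℤˣ) (i j : Fin N) :
    ‖spinDeriv (upperIndex i j) (fun y => spinGreen z y j i) x +
      ((√(N : ℝ))⁻¹ : ℝ) * (spinGreen z x j i ^ 2 + spinGreen z x j j * spinGreen z x i i)‖ ≤
      8 * (√(N : ℝ))⁻¹ ^ 2 * z.im⁻¹ ^ 3 + if i = j then 3 * (√(N : ℝ))⁻¹ * z.im⁻¹ ^ 2 else 0 := by
  set x' := flip (upperIndex i j) x with hx'
  set q : ℝ := (√(N : ℝ))⁻¹ with hq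
  have hq0 : 0 ≤ q := by positivity
  have hi : 0 < z.im⁻¹ := inv_pos.2 hz
  have hε : (spin x (upperIndex i j) : ℂ) * spin x (upperIndex i j) = 1 := by
    exact_mod_cast spin_mul_self x (upperIndex i j)
  have hD : spinDeriv (upperIndex i j) (fun y => spinGreen z y j i) x =
      -q * (spinGreen z x j i * spinGreen z x' j i +
        (if i = j then 0 else 1) * (spinGreen z x j j * spinGreen z x' i i)) := by
    rw [spinDeriv, spinGreen_sub_flip hz]
    linear_combination (-q * (spinGreen z x j i * spinGreen z x' j i +
        (if i = j then 0 else 1) * (spinGreen z x j j * spinGreen z x' i i))) * hε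
  have hg := norm_spinGreen_le (N := N) hz
  rw [hD]
  by_cases hij : i = j
  · subst hij
    simp only [if_true, zero_mul, add_zero]
    have e : -(q : ℂ) * (spinGreen z x i i * spinGreen z x' i i) +
        q * (spinGreen z x i i ^ 2 + spinGreen z x i i * spinGreen z x i i) =
        q * (spinGreen z x i i * (spinGreen z x i i + spinGreen z x i i - spinGreen z x' i i)) := by
      ring
    rw [e, norm_mul, norm_mul, Complex.norm_real, Real.norm_eq_abs, abs_of_nonneg hq0]
    have h3 : ‖spinGreen z x i i + spinGreen z x i i - spinGreen z x' i i‖ ≤ 3 * z.im⁻¹ := by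
      refine (norm_sub_le _ _).trans ?_
      have := norm_add_le (spinGreen z x i i) (spinGreen z x i i)
      linarith [hg x i i, hg x' i i]
    have : q * (‖spinGreen z x i i‖ *
        ‖spinGreen z x i i + spinGreen z x i i - spinGreen z x' i i‖) ≤
        q * (z.im⁻¹ * (3 * z.im⁻¹)) := by
      have := hg x i i
      gcongr
    have h8 : 0 ≤ 8 * q ^ 2 * z.im⁻¹ ^ 3 := by positivity
    linarith
  · simp only [if_neg hij, one_mul, add_zero]
    have e : -(q : ℂ) * (spinGreen z x j i * spinGreen z x' j i +
          spinGreen z x j j * spinGreen z x' i i) +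
        q * (spinGreen z x j i ^ 2 + spinGreen z x j j * spinGreen z x i i) =
        q * (spinGreen z x j i * (spinGreen z x j i - spinGreen z x' j i) +
          spinGreen z x j j * (spinGreen z x i i - spinGreen z x' i i)) := by
      ring
    rw [e, norm_mul, Complex.norm_real, Real.norm_eq_abs, abs_of_nonneg hq0]
    have h1 : ∀ a b c d : Fin N, ‖spinGreen z x a b * (spinGreen z x c d - spinGreen z x' c d)‖ ≤
        z.im⁻¹ * (4 * q * z.im⁻¹ ^ 2) := by
      intro a b c d
      rw [norm_mul]
      exact mul_le_mul (hg x a b) (norm_spinGreen_sub_flip_le hz x i j c d) (norm_nonneg _) hi.le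
    have h2 := (norm_add_le (spinGreen z x j i * (spinGreen z x j i - spinGreen z x' j i))
      (spinGreen z x j j * (spinGreen z x i i - spinGreen z x' i i)))
    have h3 := h2.trans (add_le_add (h1 j i j i) (h1 j j i i))
    calc _ ≤ q * (z.im⁻¹ * (4 * q * z.im⁻¹ ^ 2) + z.im⁻¹ * (4 * q * z.im⁻¹ ^ 2)) := by gcongr
      _ = _ := by ring

/-- By the discrete Leibniz rule the derivative falls either on the resolvent entry, which gives the
main term, or on the defect, which a single flip changes by only O(N^(-3/2)). -/
theorem norm_spinDeriv_defect_mul_le {z : ℂ} (hz : 0 < z.im) {t : ℝ} (ht : |t| ≤ 1) (x : Fin N × Fin N → ℤˣ)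
    (i j : Fin N) :
    ‖spinDeriv (upperIndex i j) (fun y => starRingEnd ℂ (defect z t y) * spinGreen z y j i) x +
      ((√(N : ℝ))⁻¹ : ℝ) * starRingEnd ℂ (defect z t x) *
        (spinGreen z x j i ^ 2 + spinGreen z x j j * spinGreen z x i i)‖ ≤
      (1 + ‖z‖ * z.im⁻¹ + z.im⁻¹ ^ 2) * (8 * (√(N : ℝ))⁻¹ ^ 2 * z.im⁻¹ ^ 3 +
        if i = j then 3 * (√(N : ℝ))⁻¹ * z.im⁻¹ ^ 2 else 0) +
      2 * (√(N : ℝ))⁻¹ * z.im⁻¹ ^ 3 * (‖z‖ + 2 * z.im⁻¹) * (N : ℝ)⁻¹ := by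
  have hi : 0 < z.im⁻¹ := inv_pos.2 hz
  have e : spinDeriv (upperIndex i j) (fun y => starRingEnd ℂ (defect z t y) * spinGreen z y j i) x +
      ((√(N : ℝ))⁻¹ : ℝ) * starRingEnd ℂ (defect z t x) *
        (spinGreen z x j i ^ 2 + spinGreen z x j j * spinGreen z x i i) =
      starRingEnd ℂ (defect z t x) *
        (spinDeriv (upperIndex i j) (fun y => spinGreen z y j i) x +
      ((√(N : ℝ))⁻¹ : ℝ) * (spinGreen z x j i ^ 2 + spinGreen z x j j * spinGreen z x i i)) +
      (spin x (upperIndex i j) : ℂ) / 2 *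
        starRingEnd ℂ (defect z t x - defect z t (flip (upperIndex i j) x)) *
        spinGreen z (flip (upperIndex i j) x) j i := by
    simp only [spinDeriv, map_sub]
    ring
  rw [e]
  refine (norm_add_le _ _).trans (add_le_add ?_ ?_)
  · rw [norm_mul, RCLike.norm_conj]
    exact mul_le_mul (norm_defect_le hz ht x) (norm_spinDeriv_spinGreen_add_le hz x i j)
      (norm_nonneg _) (by positivity)
  · rw [norm_mul, norm_mul, RCLike.norm_conj, norm_div, Complex.norm_real, Real.norm_eq_abs,
      abs_spin]
    have h1 := norm_defect_sub_flip_le hz ht x i j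
    have h2 := norm_spinGreen_le hz (flip (upperIndex i j) x) j i
    calc _ ≤ 1 / ‖(2 : ℂ)‖ * ((‖z‖ + 2 * z.im⁻¹) *
          (4 * (√(N : ℝ))⁻¹ * z.im⁻¹ ^ 2 * (N : ℝ)⁻¹)) * z.im⁻¹ := by gcongr
      _ = _ := by rw [RCLike.norm_ofNat]; ring

/-! ### The mean square of the defect. -/

theorem defect_eq {z : ℂ} (hz : 0 < z.im) (hN : 0 < N) (t : ℝ) (x : Fin N × Fin N → ℤˣ) :
    defect z t x = (N : ℂ)⁻¹ * ((√(N : ℝ))⁻¹ : ℝ) *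
      (∑ i, ∑ j, (spin x (upperIndex i j) : ℂ) * spinGreen z x j i) +
      (1 - (t : ℂ) ^ 2) * spinStieltjes z x ^ 2 := by
  rw [defect]
  congr 1
  -- Averaging the diagonal of XG/√N = 1 + zG expresses 1 + zs linearly in the spins, ready for
  -- integration by parts.
  have h := map_mul_green (normalizedMatrix_isHermitian (spin x)) hz
  have h1 : ∀ i, ∑ j, (((√(N : ℝ))⁻¹ : ℝ) : ℂ) * ((spin x (upperIndex i j) : ℂ) * spinGreen z x j i)
      = 1 + z * spinGreen z x i i := by
    intro i
    have h2 := congrFun (congrFun h i) i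
    rw [Matrix.mul_apply, Matrix.add_apply, Matrix.one_apply_eq, Matrix.smul_apply,
      smul_eq_mul] at h2
    rw [spinGreen, ← h2]
    refine Finset.sum_congr rfl fun j _ => ?_
    rw [Matrix.map_apply, normalizedMatrix_apply]
    push_cast
    ring
  rw [mul_assoc, Finset.mul_sum]
  simp only [Finset.mul_sum] at h1 ⊢
  simp only [← Finset.mul_sum] at h1 ⊢
  have hN' : (N : ℂ) ≠ 0 := by exact_mod_cast hN.ne'
  rw [Finset.mul_sum, Finset.sum_congr rfl fun i _ => h1 i, Finset.sum_add_distrib,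
    ← Finset.mul_sum, spinStieltjes]
  simp only [Finset.sum_const, Finset.card_univ, Fintype.card_fin, nsmul_eq_mul, mul_one]
  field_simp

/-- The quantity whose average over independent spins of mean `t` is the mean square of the
defect. -/
def defectRemainder (z : ℂ) (t : ℝ) (x : Fin N × Fin N → ℤˣ) : ℂ :=
  (N : ℂ)⁻¹ * ((√(N : ℝ))⁻¹ : ℝ) * ((1 - (t : ℂ) ^ 2) * (∑ i, ∑ j,
    spinDeriv (upperIndex i j) (fun y => starRingEnd ℂ (defect z t y) * spinGreen z y j i) x) +
    t * starRingEnd ℂ (defect z t x) * ∑ i, ∑ j, spinGreen z x j i) +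
  (1 - (t : ℂ) ^ 2) * starRingEnd ℂ (defect z t x) * spinStieltjes z x ^ 2

theorem sum_prodWeight_norm_defect_sq {z : ℂ} (hz : 0 < z.im) (hN : 0 < N) (t : ℝ) :
    ∑ x : Fin N × Fin N → ℤˣ, (prodWeight t x : ℂ) * (‖defect z t x‖ ^ 2 : ℝ) =
      ∑ x : Fin N × Fin N → ℤˣ, (prodWeight t x : ℂ) * defectRemainder z t x := by
  have e : ∀ x : Fin N × Fin N → ℤˣ, (prodWeight t x : ℂ) * (‖defect z t x‖ ^ 2 : ℝ) =
      (N : ℂ)⁻¹ * ((√(N : ℝ))⁻¹ : ℝ) * (∑ i, ∑ j, (prodWeight t x : ℂ) *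
        (((spin x (upperIndex i j) : ℂ) - t) *
          (starRingEnd ℂ (defect z t x) * spinGreen z x j i))) +
      (prodWeight t x : ℂ) * ((N : ℂ)⁻¹ * ((√(N : ℝ))⁻¹ : ℝ) *
        (t * starRingEnd ℂ (defect z t x) * ∑ i, ∑ j, spinGreen z x j i) +
        (1 - (t : ℂ) ^ 2) * starRingEnd ℂ (defect z t x) * spinStieltjes z x ^ 2) := by
    intro x
    rw [← Complex.normSq_eq_norm_sq, ← Complex.mul_conj]
    -- Only one of the two factors of |defect|² is expanded; the conjugate one remains as part of
    -- the test function.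
    nth_rewrite 1 [defect_eq hz hN t x]
    have e2 : (∑ i, ∑ j, (prodWeight t x : ℂ) * (((spin x (upperIndex i j) : ℂ) - t) *
          (starRingEnd ℂ (defect z t x) * spinGreen z x j i))) =
        (prodWeight t x : ℂ) * starRingEnd ℂ (defect z t x) *
          ((∑ i, ∑ j, (spin x (upperIndex i j) : ℂ) * spinGreen z x j i) -
            t * ∑ i, ∑ j, spinGreen z x j i) := by
      simp only [Finset.mul_sum, ← Finset.sum_sub_distrib]
      exact Finset.sum_congr rfl fun i _ => Finset.sum_congr rfl fun j _ => by ring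
    rw [e2]
    ring
  have e3 : ∀ x : Fin N × Fin N → ℤˣ, (prodWeight t x : ℂ) * defectRemainder z t x =
      (N : ℂ)⁻¹ * ((√(N : ℝ))⁻¹ : ℝ) * ((1 - (t : ℂ) ^ 2) * ∑ i, ∑ j, (prodWeight t x : ℂ) *
        spinDeriv (upperIndex i j) (fun y => starRingEnd ℂ (defect z t y) * spinGreen z y j i) x) +
      (prodWeight t x : ℂ) * ((N : ℂ)⁻¹ * ((√(N : ℝ))⁻¹ : ℝ) *
        (t * starRingEnd ℂ (defect z t x) * ∑ i, ∑ j, spinGreen z x j i) +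
        (1 - (t : ℂ) ^ 2) * starRingEnd ℂ (defect z t x) * spinStieltjes z x ^ 2) := by
    intro x
    simp only [← Finset.mul_sum]
    rw [defectRemainder]
    ring
  simp only [e, e3, Finset.sum_add_distrib]
  congr 1
  rw [← Finset.mul_sum, ← Finset.mul_sum, ← Finset.mul_sum]
  congr 1
  rw [Finset.sum_comm, Finset.sum_comm (s := Finset.univ (α := Fin N × Fin N → ℤˣ)), Finset.mul_sum]
  refine Finset.sum_congr rfl fun i _ => ?_
  rw [Finset.sum_comm, Finset.sum_comm (s := Finset.univ (α := Fin N × Fin N → ℤˣ)), Finset.mul_sum]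
  refine Finset.sum_congr rfl fun j _ => ?_
  exact sum_prodWeight_mul_spin_sub t (upperIndex i j)
    (fun y => starRingEnd ℂ (defect z t y) * spinGreen z y j i)

/-- The constant in the bound of the mean square of the defect. -/
def defectConst (z : ℂ) : ℝ :=
  (1 + ‖z‖ * z.im⁻¹ + z.im⁻¹ ^ 2) * (8 * z.im⁻¹ ^ 3 + 4 * z.im⁻¹ ^ 2 + z.im⁻¹) +
    2 * z.im⁻¹ ^ 3 * (‖z‖ + 2 * z.im⁻¹)

/-- The leading parts cancel: the terms -N^(-1/2) G_jj G_ii of the derivatives sum to a multiple of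
s² that removes the last summand of `defectRemainder`. What remains are the derivative errors `R`,
the sum of G_ji² (a contribution of order 1/N) and the mean term with factor t, all O(N^(-1/2)). -/
theorem norm_defectRemainder_le {z : ℂ} (hz : 0 < z.im) (hN : 0 < N) {t : ℝ} (ht : |t| ≤ 1)
    (x : Fin N × Fin N → ℤˣ) :
    ‖defectRemainder z t x‖ ≤ defectConst z * (√(N : ℝ))⁻¹ := by
  have hi : 0 < z.im⁻¹ := inv_pos.2 hz
  have hN1 : (1 : ℝ) ≤ N := by exact_mod_cast hN
  have hNC : (N : ℂ) ≠ 0 := by exact_mod_cast hN.ne'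
  set h := z.im⁻¹ with hh
  set q : ℝ := (√(N : ℝ))⁻¹ with hq
  set K := 1 + ‖z‖ * h + h ^ 2 with hK
  have hK0 : 0 ≤ K := by positivity
  have hq0 : 0 < q := by positivity
  have hq1 : q ≤ 1 := inv_le_one_of_one_le₀ (Real.one_le_sqrt.2 hN1)
  have hqq : q ^ 2 = (N : ℝ)⁻¹ := by rw [hq, inv_pow, Real.sq_sqrt (by positivity)]
  have hqqC : (q : ℂ) ^ 2 = (N : ℂ)⁻¹ := by rw [← Complex.ofReal_pow, hqq]; simp
  have hNq : (N : ℝ) * q ^ 2 = 1 := by rw [hqq]; field_simp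
  set Q := starRingEnd ℂ (defect z t x) with hQ
  have hQK : ‖Q‖ ≤ K := by rw [hQ, RCLike.norm_conj]; exact norm_defect_le hz ht x
  have hv := norm_one_sub_sq_le ht
  set v : ℂ := 1 - (t : ℂ) ^ 2 with hvdef
  set R : Fin N → Fin N → ℂ := fun i j =>
    spinDeriv (upperIndex i j) (fun y => starRingEnd ℂ (defect z t y) * spinGreen z y j i) x +
      q * Q * (spinGreen z x j i ^ 2 + spinGreen z x j j * spinGreen z x i i) with hR
  have hRle : ∀ i j, ‖R i j‖ ≤ K * (8 * q ^ 2 * h ^ 3 + if i = j then 3 * q * h ^ 2 else 0) +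
      2 * q * h ^ 3 * (‖z‖ + 2 * h) * (N : ℝ)⁻¹ := fun i j =>
    norm_spinDeriv_defect_mul_le hz ht x i j
  have hsumR : ‖∑ i, ∑ j, R i j‖ ≤ N * (K * (8 * h ^ 3 + 3 * q * h ^ 2) +
      2 * q * h ^ 3 * (‖z‖ + 2 * h)) := by
    calc ‖∑ i, ∑ j, R i j‖ ≤ ∑ i, ∑ j, (K * (8 * q ^ 2 * h ^ 3 +
          if i = j then 3 * q * h ^ 2 else 0) + 2 * q * h ^ 3 * (‖z‖ + 2 * h) * (N : ℝ)⁻¹) := by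
          refine (norm_sum_le _ _).trans (Finset.sum_le_sum fun i _ => ?_)
          exact (norm_sum_le _ _).trans (Finset.sum_le_sum fun j _ => hRle i j)
      _ = N * (K * (8 * (N * q ^ 2) * h ^ 3 + 3 * q * h ^ 2) +
          2 * q * h ^ 3 * (‖z‖ + 2 * h)) := by
          simp only [Finset.sum_add_distrib, ← Finset.mul_sum, Finset.sum_ite_eq,
            Finset.mem_univ, if_true, Finset.sum_const, Finset.card_univ, Fintype.card_fin,
            nsmul_eq_mul]
          field_simp
      _ = _ := by rw [hNq, mul_one]
  have hs2 : ‖∑ i, ∑ j, spinGreen z x j i ^ 2‖ ≤ N * h ^ 2 := by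
    rw [Finset.sum_comm]
    refine (norm_sum_le _ _).trans ?_
    calc _ ≤ ∑ i : Fin N, h ^ 2 := by
          refine Finset.sum_le_sum fun j _ => (norm_sum_le _ _).trans ?_
          simp only [norm_pow]
          exact sum_norm_sq_green_le _ hz j
      _ = _ := by simp
  have hs1 : ‖∑ i, ∑ j, spinGreen z x j i‖ ≤ N * h := by
    rw [Finset.sum_comm, mul_comm]
    have h' := norm_sum_green_le (normalizedMatrix_isHermitian (spin x)) hz
    rwa [Fintype.card_fin] at h'
  have hprod : ∑ i, ∑ j, spinGreen z x j j * spinGreen z x i i = (N * spinStieltjes z x) ^ 2 := by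
    rw [spinStieltjes, mul_inv_cancel_left₀ hNC, sq, Finset.sum_mul_sum]
    exact Finset.sum_congr rfl fun i _ => Finset.sum_congr rfl fun j _ => mul_comm _ _
  have e : defectRemainder z t x = (N : ℂ)⁻¹ * q * (v * (∑ i, ∑ j, R i j) +
      t * Q * ∑ i, ∑ j, spinGreen z x j i) -
      (N : ℂ)⁻¹ ^ 2 * (v * Q * ∑ i, ∑ j, spinGreen z x j i ^ 2) := by
    have hsum : ∑ i, ∑ j, R i j = (∑ i, ∑ j, spinDeriv (upperIndex i j)
        (fun y => starRingEnd ℂ (defect z t y) * spinGreen z y j i) x) +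
        q * Q * ((∑ i, ∑ j, spinGreen z x j i ^ 2) + (N * spinStieltjes z x) ^ 2) := by
      rw [← hprod]
      simp only [hR, Finset.sum_add_distrib, mul_add, Finset.mul_sum]
    rw [hsum, defectRemainder]
    have h3 : (N : ℂ)⁻¹ * q * (v * (q * Q * ((∑ i, ∑ j, spinGreen z x j i ^ 2) +
        (N * spinStieltjes z x) ^ 2))) = (N : ℂ)⁻¹ ^ 2 * (v * Q * ∑ i, ∑ j, spinGreen z x j i ^ 2) +
        v * Q * spinStieltjes z x ^ 2 := by
      have : (N : ℂ)⁻¹ * q * (v * (q * Q * ((∑ i, ∑ j, spinGreen z x j i ^ 2) +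
        (N * spinStieltjes z x) ^ 2))) = (N : ℂ)⁻¹ * q ^ 2 * (v * Q * ((∑ i, ∑ j, spinGreen z x j i ^ 2) +
        (N * spinStieltjes z x) ^ 2)) := by ring
      rw [this, hqqC]
      field_simp
    linear_combination -h3
  have b1 : ‖(N : ℂ)⁻¹ * q * (v * (∑ i, ∑ j, R i j) + t * Q * ∑ i, ∑ j, spinGreen z x j i)‖ ≤
      (N : ℝ)⁻¹ * q * (1 * (N * (K * (8 * h ^ 3 + 3 * q * h ^ 2) +
      2 * q * h ^ 3 * (‖z‖ + 2 * h))) + 1 * K * (N * h)) := by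
    rw [norm_mul, norm_mul, norm_inv, Complex.norm_natCast, Complex.norm_real, Real.norm_eq_abs,
      abs_of_pos hq0]
    refine mul_le_mul_of_nonneg_left ((norm_add_le _ _).trans (add_le_add ?_ ?_)) (by positivity)
    · rw [norm_mul]; gcongr
    · rw [norm_mul, norm_mul, Complex.norm_real, Real.norm_eq_abs]; gcongr
  have b2 : ‖(N : ℂ)⁻¹ ^ 2 * (v * Q * ∑ i, ∑ j, spinGreen z x j i ^ 2)‖ ≤
      (N : ℝ)⁻¹ ^ 2 * (1 * K * (N * h ^ 2)) := by
    rw [norm_mul, norm_pow, norm_inv, Complex.norm_natCast, norm_mul, norm_mul]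
    gcongr
  rw [e]
  refine (norm_sub_le _ _).trans ((add_le_add b1 b2).trans ?_)
  have c1 : (N : ℝ)⁻¹ * q * (1 * (N * (K * (8 * h ^ 3 + 3 * q * h ^ 2) +
      2 * q * h ^ 3 * (‖z‖ + 2 * h))) + 1 * K * (N * h)) =
      q * (K * (8 * h ^ 3 + 3 * q * h ^ 2) + 2 * q * h ^ 3 * (‖z‖ + 2 * h) + K * h) := by
    field_simp
  have c2 : (N : ℝ)⁻¹ ^ 2 * (1 * K * (N * h ^ 2)) = q * (q * (K * h ^ 2)) := by
    rw [show q * (q * (K * h ^ 2)) = q ^ 2 * (K * h ^ 2) by ring, hqq]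
    field_simp
  rw [c1, c2, ← mul_add, mul_comm]
  refine mul_le_mul_of_nonneg_right ?_ hq0.le
  rw [defectConst]
  -- Since q ≤ 1, the diagonal error 3qKh² and the term qKh² from the sum of G_ji² together fit into
  -- the 4h² of `defectConst`.
  have d1 : q * (K * h ^ 2) ≤ 1 * (K * h ^ 2) := by gcongr
  have d2 : q * (h ^ 3 * (‖z‖ + 2 * h)) ≤ 1 * (h ^ 3 * (‖z‖ + 2 * h)) := by gcongr
  nlinarith [d1, d2]

theorem sum_prodWeight_norm_defect_sq_le {z : ℂ} (hz : 0 < z.im) (hN : 0 < N) {t : ℝ}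
    (ht : |t| ≤ 1) :
    ∑ x : Fin N × Fin N → ℤˣ, prodWeight t x * ‖defect z t x‖ ^ 2 ≤
      defectConst z * (√(N : ℝ))⁻¹ := by
  have h := congrArg norm (sum_prodWeight_norm_defect_sq hz hN t)
  have e : ∑ x : Fin N × Fin N → ℤˣ, (prodWeight t x : ℂ) * (‖defect z t x‖ ^ 2 : ℝ) =
      ((∑ x : Fin N × Fin N → ℤˣ, prodWeight t x * ‖defect z t x‖ ^ 2 : ℝ) : ℂ) := by
    push_cast; rfl
  rw [e, Complex.norm_real] at h
  refine (Real.le_norm_self _).trans ?_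
  rw [h]
  refine (norm_sum_le _ _).trans ?_
  calc _ ≤ ∑ x : Fin N × Fin N → ℤˣ, prodWeight t x * (defectConst z * (√(N : ℝ))⁻¹) := by
        refine Finset.sum_le_sum fun x _ => ?_
        rw [norm_mul, Complex.norm_real, Real.norm_eq_abs, abs_of_nonneg (prodWeight_nonneg ht x)]
        exact mul_le_mul_of_nonneg_left (norm_defectRemainder_le hz hN ht x)
          (prodWeight_nonneg ht x)
    _ = _ := by rw [← Finset.sum_mul, sum_prodWeight, one_mul]

theorem sum_prodWeight_norm_defect_le {z : ℂ} (hz : 0 < z.im) (hN : 0 < N) {t : ℝ}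
    (ht : |t| ≤ 1) :
    ∑ x : Fin N × Fin N → ℤˣ, prodWeight t x * ‖defect z t x‖ ≤
      √(defectConst z * (√(N : ℝ))⁻¹) := by
  refine Real.le_sqrt_of_sq_le ?_
  refine le_trans ?_ (sum_prodWeight_norm_defect_sq_le hz hN ht)
  refine (Finset.sum_sq_le_sum_mul_sum_of_sq_le_mul Finset.univ (f := prodWeight t)
    (fun x _ => prodWeight_nonneg ht x) (g := fun x => prodWeight t x * ‖defect z t x‖ ^ 2)
    (fun x _ => mul_nonneg (prodWeight_nonneg ht x) (by positivity)) fun x _ => le_of_eq (by ring)).trans_eq ?_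
  rw [sum_prodWeight, one_mul]

end SelfConsistent

/-! ### The semicircle distribution -/

/-- `Real.sqrt` vanishes at nonpositive arguments, so the case distinction in the density is
redundant. -/
theorem semicircle_density_eq (v x : ℝ) :
    (if |x| ≤ 2 * √v then 1 / (2 * Real.pi * v) * √(4 * v - x ^ 2) else 0) =
      1 / (2 * Real.pi * v) * √(4 * v - x ^ 2) := by
  split_ifs with h
  · rfl
  · have : 4 * v - x ^ 2 ≤ 0 := by
      push Not at h
      have h2 : (2 * √v) ^ 2 ≤ |x| ^ 2 := by gcongr
      rw [mul_pow, sq_abs] at h2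
      rcases le_or_gt 0 v with hv | hv
      · rw [Real.sq_sqrt hv] at h2; linarith
      · nlinarith [sq_nonneg x]
    rw [Real.sqrt_eq_zero_of_nonpos this, mul_zero]

theorem semicircle_eq (v : ℝ) : semicircle v =
    volume.withDensity fun x => ENNReal.ofReal (1 / (2 * Real.pi * v) * √(4 * v - x ^ 2)) := by
  rw [semicircle]
  simp only [semicircle_density_eq]

theorem semicircle_density_support {v : ℝ} (hv : 0 < v) :
    (Function.support fun x : ℝ => 1 / (2 * Real.pi * v) * √(4 * v - x ^ 2)) ⊆
      Set.Ioo (-(2 * √v)) (2 * √v) := by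
  intro x hx
  have h1 : √(4 * v - x ^ 2) ≠ 0 := fun h => hx (by simp [h])
  have h2 : 0 < 4 * v - x ^ 2 := by
    by_contra! h
    exact h1 (Real.sqrt_eq_zero_of_nonpos h)
  refine abs_lt.1 (abs_lt_of_sq_lt_sq ?_ (by positivity))
  rw [mul_pow, Real.sq_sqrt hv.le]
  linarith

theorem isFiniteMeasure_semicircle {v : ℝ} (hv : 0 < v) : IsFiniteMeasure (semicircle v) := by
  rw [semicircle_eq]
  refine isFiniteMeasure_withDensity_ofReal (Integrable.hasFiniteIntegral ?_)
  refine Continuous.integrable_of_hasCompactSupport (by fun_prop) ?_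
  refine HasCompactSupport.intro (isCompact_Icc (a := -(2 * √v)) (b := 2 * √v)) fun x hx => ?_
  by_contra h
  exact hx (Set.Ioo_subset_Icc_self (semicircle_density_support hv h))

/-- The substitution x = 2√v cos θ turns the density into (2/π) sin² θ on [0, π]; it reverses
orientation, which accounts for the sign changes in the proof. -/
theorem integral_semicircle {v : ℝ} (hv : 0 < v) {f : ℝ → ℂ} (hf : Continuous f) :
    ∫ x, f x ∂semicircle v =
      (2 / Real.pi : ℝ) • ∫ θ in 0..Real.pi, (Real.sin θ ^ 2) • f (2 * √v * Real.cos θ) := by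
  have hR : 0 < 2 * √v := by positivity
  have hpi := Real.pi_pos
  rw [semicircle_eq, integral_withDensity_eq_integral_toReal_smul (by fun_prop)
    (Eventually.of_forall fun _ => ENNReal.ofReal_lt_top)]
  have e1 : ∀ x, (ENNReal.ofReal (1 / (2 * Real.pi * v) * √(4 * v - x ^ 2))).toReal • f x =
      (1 / (2 * Real.pi * v) * √(4 * v - x ^ 2)) • f x := fun x => by
    rw [ENNReal.toReal_ofReal (by positivity)]
  simp only [e1]
  have hsupp : (Function.support fun x => (1 / (2 * Real.pi * v) * √(4 * v - x ^ 2)) • f x) ⊆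
      Set.Ioc (-(2 * √v)) (2 * √v) := fun x hx => Set.Ioo_subset_Ioc_self
    (semicircle_density_support hv fun h0 => hx (by
      have h1 : 1 / (2 * Real.pi * v) * √(4 * v - x ^ 2) = 0 := h0
      simp only [h1, zero_smul]))
  rw [← intervalIntegral.integral_eq_integral_of_support_subset hsupp]
  have hsub := intervalIntegral.integral_deriv_smul_comp (a := 0) (b := Real.pi)
    (f := fun θ => 2 * √v * Real.cos θ) (f' := fun θ => 2 * √v * (-Real.sin θ))
    (g := fun x => (1 / (2 * Real.pi * v) * √(4 * v - x ^ 2)) • f x)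
    (fun θ _ => (Real.hasDerivAt_cos θ).const_mul _) (by fun_prop) (by fun_prop)
  simp only [Real.cos_zero, Real.cos_pi, mul_one, mul_neg_one] at hsub
  rw [intervalIntegral.integral_symm, ← hsub, ← intervalIntegral.integral_neg,
    ← intervalIntegral.integral_smul]
  refine intervalIntegral.integral_congr fun θ hθ => ?_
  rw [Set.uIcc_of_le hpi.le] at hθ
  have hs := Real.sin_nonneg_of_mem_Icc hθ
  have e2 : √(4 * v - (2 * √v * Real.cos θ) ^ 2) = 2 * √v * Real.sin θ := by
    rw [← Real.sqrt_sq (show 0 ≤ 2 * √v * Real.sin θ by positivity)]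
    congr 1
    rw [mul_pow, mul_pow, mul_pow, mul_pow, Real.sq_sqrt hv.le, Real.cos_sq']
    ring
  simp only [Function.comp_apply, e2, smul_smul, ← neg_smul]
  congr 1
  have : √v * √v = v := Real.mul_self_sqrt hv.le
  field_simp
  linear_combination Real.sin θ ^ 2 * this

theorem integral_one_semicircle {v : ℝ} (hv : 0 < v) : ∫ _, (1 : ℂ) ∂semicircle v = 1 := by
  rw [integral_semicircle hv continuous_const]
  have h : ∫ θ in 0..Real.pi, (Real.sin θ ^ 2) • (1 : ℂ) = ((Real.pi / 2 : ℝ) : ℂ) := by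
    have := integral_sin_sq (a := 0) (b := Real.pi)
    simp only [Complex.real_smul, mul_one]
    rw [intervalIntegral.integral_ofReal, this]
    simp
  rw [h, Complex.real_smul, ← Complex.ofReal_mul]
  have := Real.pi_pos
  rw [show 2 / Real.pi * (Real.pi / 2) = 1 by field_simp]
  simp

theorem isProbabilityMeasure_semicircle {v : ℝ} (hv : 0 < v) :
    IsProbabilityMeasure (semicircle v) := by
  have := isFiniteMeasure_semicircle hv
  have h := integral_one_semicircle hv
  rw [integral_const, Complex.real_smul, mul_one, Complex.ofReal_eq_one] at h
  constructor
  rwa [measureReal_def, ENNReal.toReal_eq_one_iff] at h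

/-- The point `e ^ (i θ)` of the unit circle. -/
def expI (θ : ℝ) : ℂ := Complex.exp (θ * Complex.I)

theorem continuous_expI : Continuous expI := by unfold expI; fun_prop

theorem expI_ne_zero (θ : ℝ) : expI θ ≠ 0 := Complex.exp_ne_zero _

theorem norm_expI (θ : ℝ) : ‖expI θ‖ = 1 := Complex.norm_exp_ofReal_mul_I θ

theorem expI_sub (θ : ℝ) : expI (2 * Real.pi - θ) = (expI θ)⁻¹ := by
  rw [expI, expI, ← Complex.exp_neg]
  push_cast
  rw [sub_mul, sub_eq_add_neg, add_comm, Complex.exp_add]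
  rw [Complex.exp_two_pi_mul_I, mul_one]

theorem sin_eq_expI (θ : ℝ) : (Real.sin θ : ℂ) = (expI θ - (expI θ)⁻¹) / (2 * Complex.I) := by
  rw [Complex.ofReal_sin, Complex.sin, expI, ← Complex.exp_neg, neg_mul]
  field_simp
  rw [Complex.I_sq]
  ring

theorem cos_eq_expI (θ : ℝ) : (Real.cos θ : ℂ) = (expI θ + (expI θ)⁻¹) / 2 := by
  rw [Complex.ofReal_cos, Complex.cos, expI, ← Complex.exp_neg, neg_mul]

theorem one_add_mul_ne_zero {w ζ : ℂ} (hw : ‖w‖ < 1) (hζ : ‖ζ‖ ≤ 1) : 1 + w * ζ ≠ 0 := by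
  intro h
  have h1 : w * ζ = -1 := by linear_combination h
  have h2 := congrArg norm h1
  rw [norm_mul, norm_neg, norm_one] at h2
  nlinarith [norm_nonneg w, norm_nonneg ζ]

/-- On the unit circle sin θ = (ζ² - 1)/(2iζ), so this is Cauchy's formula for the derivative at 0
of (ζ² - 1)/(1 + wζ). -/
theorem integral_sin_div {w : ℂ} (hw : ‖w‖ < 1) :
    ∫ θ in 0..2 * Real.pi, (Real.sin θ : ℂ) / (1 + w * expI θ) = -(Real.pi * Complex.I * w) := by
  have hd : DifferentiableOn ℂ (fun ζ : ℂ => (ζ ^ 2 - 1) / (1 + w * ζ)) (Metric.closedBall 0 1) := by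
    intro ζ hζ
    have := one_add_mul_ne_zero hw (by simpa using hζ)
    exact DifferentiableAt.differentiableWithinAt (by fun_prop (disch := exact this))
  have h := hd.deriv_eq_smul_circleIntegral one_pos
  have hder : deriv (fun ζ : ℂ => (ζ ^ 2 - 1) / (1 + w * ζ)) 0 = w := by
    have h1 : HasDerivAt (fun ζ : ℂ => ζ ^ 2 - 1) 0 0 := by
      simpa using (hasDerivAt_pow 2 (0 : ℂ)).sub_const 1
    have h2 : HasDerivAt (fun ζ : ℂ => 1 + w * ζ) w 0 := by
      simpa using ((hasDerivAt_id (0 : ℂ)).const_mul w).const_add 1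
    have h3 := h1.fun_div h2 (by simp)
    rw [h3.deriv]
    simp
  rw [hder, circleIntegral] at h
  have e : ∀ θ : ℝ, deriv (circleMap 0 1) θ • ((1 / (circleMap 0 1 θ - 0) ^ 2) •
      ((circleMap 0 1 θ ^ 2 - 1) / (1 + w * circleMap 0 1 θ))) =
      -2 * ((Real.sin θ : ℂ) / (1 + w * expI θ)) := by
    intro θ
    have hc : circleMap 0 1 θ = expI θ := by simp [circleMap, expI]
    rw [deriv_circleMap, hc, sin_eq_expI]
    have := expI_ne_zero θ
    have h2 := one_add_mul_ne_zero hw (norm_expI θ).le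
    simp only [smul_eq_mul, sub_zero]
    field_simp
    rw [Complex.I_sq]
    ring
  simp only [e] at h
  rw [intervalIntegral.integral_const_mul, smul_eq_mul] at h
  linear_combination (-1 / 2) * h

/-- The integrand is symmetric under θ ↦ 2π - θ, so the integral is half of that over the full
circle. Partial fractions split it into two pieces that the same reflection exchanges up to sign,
each given by `integral_sin_div`. -/
theorem integral_sin_sq_div {w : ℂ} (hw : ‖w‖ < 1) (hw0 : w ≠ 0) :
    ∫ θ in 0..Real.pi, (Real.sin θ : ℂ) ^ 2 / ((1 + w * expI θ) * (1 + w * (expI θ)⁻¹)) =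
      (Real.pi : ℂ) / 2 := by
  have ha : ∀ θ, 1 + w * expI θ ≠ 0 := fun θ => one_add_mul_ne_zero hw (norm_expI θ).le
  have hb : ∀ θ, 1 + w * (expI θ)⁻¹ ≠ 0 := fun θ =>
    one_add_mul_ne_zero hw (by rw [norm_inv, norm_expI, inv_one])
  have hce := continuous_expI
  have hci : Continuous fun θ => (expI θ)⁻¹ := hce.inv₀ expI_ne_zero
  have hcs : Continuous fun θ : ℝ => (Real.sin θ : ℂ) := by fun_prop
  set F : ℝ → ℂ := fun θ => (Real.sin θ : ℂ) ^ 2 / ((1 + w * expI θ) * (1 + w * (expI θ)⁻¹)) with hF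
  have hFc : Continuous F := (hcs.pow 2).div
    ((continuous_const.add (continuous_const.mul hce)).mul
      (continuous_const.add (continuous_const.mul hci))) fun θ => mul_ne_zero (ha θ) (hb θ)
  have hAc : Continuous fun θ => (Real.sin θ : ℂ) / (1 + w * expI θ) :=
    hcs.div (continuous_const.add (continuous_const.mul hce)) ha
  have hBc : Continuous fun θ => (Real.sin θ : ℂ) / (1 + w * (expI θ)⁻¹) :=
    hcs.div (continuous_const.add (continuous_const.mul hci)) hb
  have hsin : ∀ θ, Real.sin (2 * Real.pi - θ) = -Real.sin θ := Real.sin_two_pi_sub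
  have hhalf : ∫ θ in 0..2 * Real.pi, F θ = 2 * ∫ θ in 0..Real.pi, F θ := by
    rw [← intervalIntegral.integral_add_adjacent_intervals (b := Real.pi)
      (hFc.intervalIntegrable _ _) (hFc.intervalIntegrable _ _), two_mul (∫ θ in 0..Real.pi, F θ)]
    congr 1
    have h := intervalIntegral.integral_comp_sub_left F (a := 0) (b := Real.pi) (2 * Real.pi)
    rw [show 2 * Real.pi - Real.pi = Real.pi by ring, sub_zero] at h
    rw [← h]
    refine intervalIntegral.integral_congr fun θ _ => ?_
    simp only [hF, hsin, expI_sub, inv_inv]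
    push_cast
    rw [neg_sq, mul_comm (1 + w * expI θ)]
  have hrefl : ∫ θ in 0..2 * Real.pi, (Real.sin θ : ℂ) / (1 + w * (expI θ)⁻¹) =
      -∫ θ in 0..2 * Real.pi, (Real.sin θ : ℂ) / (1 + w * expI θ) := by
    have h := intervalIntegral.integral_comp_sub_left
      (fun θ => (Real.sin θ : ℂ) / (1 + w * expI θ)) (a := 0) (b := 2 * Real.pi) (2 * Real.pi)
    rw [sub_self, sub_zero] at h
    rw [← h, ← intervalIntegral.integral_neg]
    refine intervalIntegral.integral_congr fun θ _ => ?_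
    simp only [hsin, expI_sub]
    push_cast
    ring
  have hsplit : ∀ θ, F θ = Complex.I / (2 * w) * ((Real.sin θ : ℂ) / (1 + w * expI θ) -
      (Real.sin θ : ℂ) / (1 + w * (expI θ)⁻¹)) := by
    intro θ
    have h1 := ha θ
    have h2 := hb θ
    have h3 : (expI θ)⁻¹ - expI θ = -(2 * Complex.I) * Real.sin θ := by
      rw [sin_eq_expI]; field_simp; ring
    simp only [hF]
    rw [div_sub_div _ _ h1 h2]
    rw [show (Real.sin θ : ℂ) * (1 + w * (expI θ)⁻¹) - (1 + w * expI θ) * Real.sin θ =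
      Real.sin θ * w * ((expI θ)⁻¹ - expI θ) by ring, h3]
    rw [← mul_div_assoc]
    congr 1
    field_simp
    rw [Complex.I_sq]
    ring
  have hfull : ∫ θ in 0..2 * Real.pi, F θ = Real.pi := by
    simp only [hsplit]
    rw [intervalIntegral.integral_const_mul, intervalIntegral.integral_sub
      (hAc.intervalIntegrable _ _) (hBc.intervalIntegrable _ _), hrefl, integral_sin_div hw]
    field_simp
    ring_nf
    rw [Complex.I_sq]
    ring
  rw [hhalf] at hfull
  linear_combination hfull / 2

/-- Joukowski parametrization: the quadratic for w has roots w and 1/w, and |w| = 1 would make z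
real, so one root lies inside the disc. -/
theorem exists_root {z : ℂ} (hz : 0 < z.im) {r : ℝ} (hr : 0 < r) :
    ∃ w : ℂ, w ≠ 0 ∧ ‖w‖ < 1 ∧ z = -(r * (w + w⁻¹)) := by
  obtain ⟨s, hs⟩ := IsAlgClosed.exists_pow_nat_eq (discrim (r : ℂ) z r) two_pos
  have hrC : (r : ℂ) ≠ 0 := by exact_mod_cast hr.ne'
  obtain ⟨w, hw⟩ := exists_quadratic_eq_zero hrC ⟨s, by rw [← hs, sq]⟩
  have hw0 : w ≠ 0 := by
    rintro rfl
    simp at hw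
    exact hr.ne' hw
  have hzw : z = -(r * (w + w⁻¹)) := by
    field_simp
    linear_combination hw
  rcases lt_trichotomy ‖w‖ 1 with h | h | h
  · exact ⟨w, hw0, h, hzw⟩
  · exfalso
    have hinv : w⁻¹ = starRingEnd ℂ w := Complex.inv_eq_conj h
    rw [hinv, Complex.add_conj] at hzw
    rw [hzw] at hz
    simp at hz
  · exact ⟨w⁻¹, inv_ne_zero hw0, by rw [norm_inv]; exact inv_lt_one_of_one_lt₀ h,
      by rw [hzw, inv_inv, add_comm]⟩

theorem continuous_inv_sub {z : ℂ} (hz : 0 < z.im) : Continuous fun x : ℝ => ((x : ℂ) - z)⁻¹ :=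
  (Complex.continuous_ofReal.sub continuous_const).inv₀ fun x => ofReal_sub_ne_zero hz x

/-- The Stieltjes transform of the semicircle distribution. -/
def semicircleStieltjes (v : ℝ) (z : ℂ) : ℂ := ∫ x, ((x : ℂ) - z)⁻¹ ∂semicircle v

/-- With z = -√v (w + 1/w), the denominator 2√v cos θ - z factors as (√v/w)(1 + we^(iθ))(1 +
we^(-iθ)). The transform is then w/√v, and the equation is immediate. -/
theorem semicircleStieltjes_eq {v : ℝ} (hv : 0 < v) {z : ℂ} (hz : 0 < z.im) :
    1 + z * semicircleStieltjes v z + v * semicircleStieltjes v z ^ 2 = 0 := by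
  have hr : 0 < √v := Real.sqrt_pos.2 hv
  obtain ⟨w, hw0, hw, hzw⟩ := exists_root hz hr
  have hrC : ((√v : ℝ) : ℂ) ≠ 0 := by exact_mod_cast hr.ne'
  have hpi : (Real.pi : ℂ) ≠ 0 := by exact_mod_cast Real.pi_ne_zero
  have hs : semicircleStieltjes v z = w / (√v : ℝ) := by
    rw [semicircleStieltjes, integral_semicircle hv (continuous_inv_sub hz)]
    have e : ∀ θ : ℝ, (Real.sin θ ^ 2) • (((2 * √v * Real.cos θ : ℝ) : ℂ) - z)⁻¹ =
        w / (√v : ℝ) * ((Real.sin θ : ℂ) ^ 2 /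
          ((1 + w * expI θ) * (1 + w * (expI θ)⁻¹))) := by
      intro θ
      have ha : 1 + w * expI θ ≠ 0 := one_add_mul_ne_zero hw (norm_expI θ).le
      have hb : 1 + w * (expI θ)⁻¹ ≠ 0 :=
        one_add_mul_ne_zero hw (by rw [norm_inv, norm_expI, inv_one])
      have h0 := expI_ne_zero θ
      have e1 : ((2 * √v * Real.cos θ : ℝ) : ℂ) - z =
          (√v : ℝ) / w * ((1 + w * expI θ) * (1 + w * (expI θ)⁻¹)) := by
        rw [hzw]
        push_cast
        rw [← Complex.ofReal_cos, cos_eq_expI]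
        field_simp
        ring
      rw [e1, Complex.real_smul, mul_inv, inv_div]
      push_cast
      ring
    simp only [e]
    rw [intervalIntegral.integral_const_mul, integral_sin_sq_div hw hw0, Complex.real_smul]
    push_cast
    field_simp
  have hvv : (v : ℂ) = ((√v : ℝ) : ℂ) ^ 2 := by
    rw [← Complex.ofReal_pow, Real.sq_sqrt hv.le]
  rw [hs, hvv, hzw]
  field_simp
  ring

theorem inv_sub_im_nonneg {z : ℂ} (hz : 0 < z.im) (x : ℝ) : 0 ≤ (((x : ℂ) - z)⁻¹).im := by
  rw [Complex.inv_im]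
  refine div_nonneg ?_ (Complex.normSq_nonneg _)
  simp [hz.le]

theorem semicircleStieltjes_im_nonneg {v : ℝ} (hv : 0 < v) {z : ℂ} (hz : 0 < z.im) :
    0 ≤ (semicircleStieltjes v z).im := by
  have := isFiniteMeasure_semicircle hv
  have hint : Integrable (fun x : ℝ => ((x : ℂ) - z)⁻¹) (semicircle v) :=
    Integrable.of_bound (continuous_inv_sub hz).aestronglyMeasurable z.im⁻¹
      (Eventually.of_forall fun x => norm_inv_ofReal_sub_le hz x)
  have h : ∫ x : ℝ, (((x : ℂ) - z)⁻¹).im ∂semicircle v = (semicircleStieltjes v z).im :=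
    integral_im hint
  rw [← h]
  exact integral_nonneg fun x => inv_sub_im_nonneg hz x

/-- Stability of the self-consistent equation. -/
theorem norm_sub_semicircleStieltjes_le {v : ℝ} (hv : 0 < v) {z : ℂ} (hz : 0 < z.im) {s : ℂ}
    (hs : 0 ≤ s.im) :
    ‖s - semicircleStieltjes v z‖ ≤ z.im⁻¹ * ‖1 + z * s + v * s ^ 2‖ := by
  -- Subtracting the exact equation leaves a factorization whose second factor has imaginary part at
  -- least Im z, since both transforms have nonnegative imaginary part.
  have e : 1 + z * s + v * s ^ 2 =
      (s - semicircleStieltjes v z) * (z + v * (s + semicircleStieltjes v z)) := by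
    linear_combination semicircleStieltjes_eq hv hz
  have him : z.im ≤ ‖z + v * (s + semicircleStieltjes v z)‖ := by
    refine le_trans ?_ ((le_abs_self _).trans (Complex.abs_im_le_norm _))
    have := semicircleStieltjes_im_nonneg hv hz
    simp only [Complex.add_im, Complex.mul_im, Complex.ofReal_re, Complex.ofReal_im, zero_mul,
      add_zero]
    nlinarith
  rw [e, norm_mul, mul_left_comm]
  refine le_mul_of_one_le_right (norm_nonneg _) ?_
  rw [← div_eq_inv_mul, one_le_div hz]
  exact him

theorem spinStieltjes_im_nonneg {N : ℕ} {z : ℂ} (hz : 0 < z.im) (x : Fin N × Fin N → ℤˣ) :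
    0 ≤ (spinStieltjes z x).im := by
  have h : ∀ c : ℂ, ((N : ℂ)⁻¹ * c).im = (N : ℝ)⁻¹ * c.im := by
    intro c
    rw [show (N : ℂ)⁻¹ = (((N : ℝ)⁻¹ : ℝ) : ℂ) by push_cast; rfl, Complex.im_ofReal_mul]
  rw [spinStieltjes, h]
  unfold spinGreen
  rw [trace_green, Complex.im_sum]
  exact mul_nonneg (by positivity) (Finset.sum_nonneg fun k _ => inv_sub_im_nonneg hz _)

/-! ### Density of the resolvents -/

theorem ofReal_sub_ne_zero' {z : ℂ} (hz : z.im ≠ 0) (x : ℝ) : (x : ℂ) - z ≠ 0 := by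
  intro h
  have := congrArg Complex.im h
  simp at this
  exact hz this

theorem tendsto_inv_ofReal_sub (z : ℂ) :
    Tendsto (fun x : ℝ => ((x : ℂ) - z)⁻¹) (coclosedCompact ℝ) (𝓝 0) := by
  rw [coclosedCompact_eq_cocompact]
  refine tendsto_inv₀_cobounded.comp ?_
  rw [← tendsto_norm_atTop_iff_cobounded]
  refine tendsto_atTop_mono (f := fun x : ℝ => ‖x‖ - ‖z‖) (fun x => ?_) ?_
  · have := norm_sub_norm_le (x : ℂ) z
    rwa [Complex.norm_real] at this
  · exact tendsto_atTop_add_const_right _ _ (tendsto_norm_cocompact_atTop (E := ℝ))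

/-- The function `1 / (x - z)`, extended by `0` to the one-point compactification of `ℝ`. -/
def invSub (z : ℂ) (hz : z.im ≠ 0) : C(OnePoint ℝ, ℂ) :=
  OnePoint.continuousMapMk ⟨fun x : ℝ => ((x : ℂ) - z)⁻¹,
    (Complex.continuous_ofReal.sub continuous_const).inv₀ (ofReal_sub_ne_zero' hz)⟩ 0
    (tendsto_inv_ofReal_sub z)

theorem invSub_coe (z : ℂ) (hz : z.im ≠ 0) (x : ℝ) :
    invSub z hz (x : OnePoint ℝ) = ((x : ℂ) - z)⁻¹ := rfl

theorem invSub_infty (z : ℂ) (hz : z.im ≠ 0) : invSub z hz OnePoint.infty = 0 := rfl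

theorem invSub_sub (z w : ℂ) (hz : z.im ≠ 0) (hw : w.im ≠ 0) :
    invSub z hz - invSub w hw = (z - w) • (invSub z hz * invSub w hw) := by
  ext x
  induction x using OnePoint.rec with
  | infty => simp [invSub_infty]
  | coe x =>
    simp only [ContinuousMap.sub_apply, ContinuousMap.smul_apply, ContinuousMap.mul_apply,
      invSub_coe, smul_eq_mul]
    have h1 := ofReal_sub_ne_zero' hz x
    have h2 := ofReal_sub_ne_zero' hw x
    field_simp
    ring

theorem norm_invSub_le (z : ℂ) (hz : z.im ≠ 0) : ‖invSub z hz‖ ≤ |z.im|⁻¹ := by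
  rw [ContinuousMap.norm_le _ (by positivity)]
  intro x
  induction x using OnePoint.rec with
  | infty => rw [invSub_infty, norm_zero]; positivity
  | coe x =>
    rw [invSub_coe, norm_inv]
    refine inv_anti₀ (abs_pos.2 hz) ?_
    simpa using Complex.abs_im_le_norm ((x : ℂ) - z)

theorem star_invSub (z : ℂ) (hz : z.im ≠ 0) :
    star (invSub z hz) = invSub (starRingEnd ℂ z) (by simpa using hz) := by
  ext x
  induction x using OnePoint.rec with
  | infty => simp [invSub_infty]
  | coe x => simp [invSub_coe]

/-- The span of the constants and the functions `1 / (x - z)`. -/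
def invSubSpan : Submodule ℂ C(OnePoint ℝ, ℂ) :=
  Submodule.span ℂ ({1} ∪ {g | ∃ z hz, g = invSub z hz})

theorem one_mem_invSubSpan : (1 : C(OnePoint ℝ, ℂ)) ∈ invSubSpan :=
  Submodule.subset_span (Or.inl rfl)

theorem invSub_mem_invSubSpan (z : ℂ) (hz : z.im ≠ 0) : invSub z hz ∈ invSubSpan :=
  Submodule.subset_span (Or.inr ⟨z, hz, rfl⟩)

/-- For distinct z and w, partial fractions write the product as a combination of the two factors.
-/
theorem invSub_mul_mem_of_ne {z w : ℂ} (hz : z.im ≠ 0) (hw : w.im ≠ 0) (h : z ≠ w) :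
    invSub z hz * invSub w hw ∈ invSubSpan := by
  have e : invSub z hz * invSub w hw = (z - w)⁻¹ • (invSub z hz - invSub w hw) := by
    rw [invSub_sub, smul_smul, inv_mul_cancel₀ (sub_ne_zero.2 h), one_smul]
  rw [e]
  exact Submodule.smul_mem _ _ (Submodule.sub_mem _ (invSub_mem_invSubSpan z hz)
    (invSub_mem_invSubSpan w hw))

/-- The square is a uniform limit of products with distinct poles; shifting z by the real number
1/(n + 1) preserves the imaginary part, hence the norm bound. -/
theorem invSub_mul_self_mem {z : ℂ} (hz : z.im ≠ 0) :
    invSub z hz * invSub z hz ∈ invSubSpan.topologicalClosure := by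
  have him : ∀ n : ℕ, (z + ((1 / (n + 1) : ℝ) : ℂ)).im ≠ 0 := by
    intro n; simpa using hz
  have hlim : Tendsto (fun n : ℕ => invSub (z + ((1 / (n + 1) : ℝ) : ℂ)) (him n)) atTop
      (𝓝 (invSub z hz)) := by
    rw [tendsto_iff_norm_sub_tendsto_zero]
    refine squeeze_zero (fun _ => norm_nonneg _) (g := fun n : ℕ =>
      (1 / (n + 1) : ℝ) * (|z.im|⁻¹ * |z.im|⁻¹)) (fun n => ?_) ?_
    · rw [invSub_sub, norm_smul, add_sub_cancel_left, Complex.norm_real, Real.norm_eq_abs,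
        abs_of_pos (by positivity)]
      refine mul_le_mul_of_nonneg_left ((norm_mul_le _ _).trans ?_) (by positivity)
      have h1 := norm_invSub_le _ (him n)
      have h2 : (z + ((1 / (n + 1) : ℝ) : ℂ)).im = z.im := by simp
      rw [h2] at h1
      exact mul_le_mul h1 (norm_invSub_le z hz) (norm_nonneg _) (by positivity)
    · simpa using (tendsto_one_div_add_atTop_nhds_zero_nat (𝕜 := ℝ)).mul_const
        (|z.im|⁻¹ * |z.im|⁻¹)
  refine mem_closure_of_tendsto (hlim.const_mul (invSub z hz)) (Eventually.of_forall fun n => ?_)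
  refine invSub_mul_mem_of_ne hz (him n) fun h => ?_
  have h2 : ((1 / (n + 1) : ℝ) : ℂ) = 0 := by linear_combination -h
  rw [Complex.ofReal_eq_zero] at h2
  have : (0 : ℝ) < 1 / (n + 1) := by positivity
  exact this.ne' h2

theorem invSubSpan_mul_mem {f g : C(OnePoint ℝ, ℂ)} (hf : f ∈ invSubSpan) (hg : g ∈ invSubSpan) :
    f * g ∈ invSubSpan.topologicalClosure := by
  have hle : invSubSpan * invSubSpan ≤ invSubSpan.topologicalClosure := by
    nth_rewrite 1 2 [invSubSpan]
    rw [Submodule.span_mul_span, Submodule.span_le]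
    rintro _ ⟨a, ha, b, hb, rfl⟩
    have hsub := Submodule.le_topologicalClosure invSubSpan
    rcases ha with rfl | ⟨z, hz, rfl⟩
    · simp only [one_mul]
      exact hsub (Submodule.subset_span hb)
    · rcases hb with rfl | ⟨w, hw, rfl⟩
      · simp only [mul_one]
        exact hsub (invSub_mem_invSubSpan z hz)
      · by_cases h : z = w
        · subst h
          exact invSub_mul_self_mem hz
        · exact hsub (invSub_mul_mem_of_ne hz hw h)
  exact hle (Submodule.mul_mem_mul hf hg)

theorem star_mem_invSubSpan {f : C(OnePoint ℝ, ℂ)} (hf : f ∈ invSubSpan) :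
    star f ∈ invSubSpan := by
  induction hf using Submodule.span_induction with
  | mem x hx =>
    rcases hx with rfl | ⟨z, hz, rfl⟩
    · rw [star_one]; exact one_mem_invSubSpan
    · rw [star_invSub]; exact invSub_mem_invSubSpan _ _
  | zero => rw [star_zero]; exact Submodule.zero_mem _
  | add x y _ _ hx hy => rw [star_add]; exact Submodule.add_mem _ hx hy
  | smul c x _ hx => rw [star_smul]; exact Submodule.smul_mem _ _ hx

/-- The closed span of the constants and the functions `1 / (x - z)` as a subalgebra. -/
def invSubAlgebra : StarSubalgebra ℂ C(OnePoint ℝ, ℂ) where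
  carrier := invSubSpan.topologicalClosure
  mul_mem' {a b} ha hb := by
    have h := map_mem_closure₂ (f := fun a b : C(OnePoint ℝ, ℂ) => a * b)
      (u := (invSubSpan.topologicalClosure : Set C(OnePoint ℝ, ℂ))) continuous_mul ha hb
      fun a ha b hb => invSubSpan_mul_mem ha hb
    rwa [(Submodule.isClosed_topologicalClosure _).closure_eq] at h
  add_mem' := Submodule.add_mem _
  algebraMap_mem' c := by
    rw [Algebra.algebraMap_eq_smul_one]
    exact Submodule.smul_mem _ _ (Submodule.le_topologicalClosure _ one_mem_invSubSpan)
  star_mem' {a} ha := map_mem_closure continuous_star ha fun _ h => star_mem_invSubSpan h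

theorem separatesPoints_invSubAlgebra : invSubAlgebra.SeparatesPoints := by
  have hI : (Complex.I).im ≠ 0 := by simp
  intro x y hxy
  refine ⟨_, ⟨invSub Complex.I hI, Submodule.le_topologicalClosure _
    (invSub_mem_invSubSpan _ hI), rfl⟩, ?_⟩
  change invSub Complex.I hI x ≠ invSub Complex.I hI y
  have hne : ∀ x : ℝ, ((x : ℂ) - Complex.I)⁻¹ ≠ 0 := fun x => inv_ne_zero (ofReal_sub_ne_zero' hI x)
  induction x using OnePoint.rec with
  | infty =>
    induction y using OnePoint.rec with
    | infty => exact absurd rfl hxy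
    | coe y => rw [invSub_coe, invSub_infty]; exact (hne y).symm
  | coe x =>
    induction y using OnePoint.rec with
    | infty => rw [invSub_coe, invSub_infty]; exact hne x
    | coe y =>
      rw [invSub_coe, invSub_coe]
      intro h
      have h2 := inv_injective h
      apply hxy
      have h3 : (x : ℂ) = y := by linear_combination h2
      rw [Complex.ofReal_injective h3]

theorem invSubSpan_topologicalClosure : invSubSpan.topologicalClosure = ⊤ := by
  have h := ContinuousMap.starSubalgebra_topologicalClosure_eq_top_of_separatesPoints
    invSubAlgebra separatesPoints_invSubAlgebra
  rw [eq_top_iff]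
  intro f _
  have hf : f ∈ invSubAlgebra.topologicalClosure := by rw [h]; trivial
  have hf2 : f ∈ closure (invSubAlgebra : Set C(OnePoint ℝ, ℂ)) := hf
  have hcl : IsClosed (invSubAlgebra : Set C(OnePoint ℝ, ℂ)) :=
    Submodule.isClosed_topologicalClosure invSubSpan
  rwa [hcl.closure_eq] at hf2

/-- A uniformly bounded sequence of star-invariant seminorms that tends to zero on the constants and
on the functions `1 / (x - z)`, `0 < z.im`, tends to zero everywhere. -/
theorem tendsto_seminorm {D : ℕ → Seminorm ℂ C(OnePoint ℝ, ℂ)} (hD : ∀ N f, D N f ≤ 2 * ‖f‖)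
    (hstar : ∀ N f, D N (star f) = D N f) (h1 : Tendsto (fun N => D N 1) atTop (𝓝 0))
    (hr : ∀ z (hz : 0 < z.im), Tendsto (fun N => D N (invSub z hz.ne')) atTop (𝓝 0))
    (f : C(OnePoint ℝ, ℂ)) : Tendsto (fun N => D N f) atTop (𝓝 0) := by
  have hspan : ∀ g ∈ invSubSpan, Tendsto (fun N => D N g) atTop (𝓝 0) := by
    intro g hg
    induction hg using Submodule.span_induction with
    | mem x hx =>
      rcases hx with rfl | ⟨z, hz, rfl⟩
      · exact h1
      · rcases hz.lt_or_gt with hz' | hz'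
        · have h := hr (starRingEnd ℂ z) (by simpa using hz')
          refine h.congr fun N => ?_
          rw [← hstar, star_invSub]
          congr 2
          simp
        · exact hr z hz'
    | zero => simp
    | add x y _ _ hx hy =>
      refine squeeze_zero (fun N => apply_nonneg _ _) (fun N => map_add_le_add (D N) x y) ?_
      simpa using hx.add hy
    | smul c x _ hx =>
      simp only [map_smul_eq_mul]
      simpa using hx.const_mul ‖c‖
  have hf : f ∈ closure (invSubSpan : Set C(OnePoint ℝ, ℂ)) := by
    have : f ∈ invSubSpan.topologicalClosure := by
      rw [invSubSpan_topologicalClosure]; trivial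
    exact this
  rw [Metric.tendsto_atTop]
  intro ε hε
  obtain ⟨g, hg, hfg⟩ := Metric.mem_closure_iff.1 hf (ε / 4) (by positivity)
  obtain ⟨N₀, hN₀⟩ := (Metric.tendsto_atTop.1 (hspan g hg)) (ε / 2) (by positivity)
  refine ⟨N₀, fun N hN => ?_⟩
  have h2 := hN₀ N hN
  rw [Real.dist_eq, sub_zero, abs_of_nonneg (apply_nonneg _ _)] at h2 ⊢
  have h3 := map_add_le_add (D N) g (f - g)
  rw [add_sub_cancel] at h3
  have h4 := hD N (f - g)
  rw [dist_eq_norm] at hfg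
  linarith

/-! ### Curie-Weiss spins as a mixture of independent spins -/

section Mixture

variable {ι : Type*}

theorem one_add_tanh_mul_spin (y : ℝ) (x : ι → ℤˣ) (i : ι) :
    Real.cosh y * (1 + Real.tanh y * spin x i) = Real.exp (y * spin x i) := by
  have hc := (Real.cosh_pos y).ne'
  rw [Real.tanh_eq_sinh_div_cosh]
  rcases spin_eq_or x i with h | h <;> rw [h]
  · rw [mul_one, mul_one, ← Real.cosh_add_sinh]; field_simp
  · rw [mul_neg_one, mul_neg_one, ← Real.cosh_sub_sinh]; field_simp; ring

variable [Fintype ι]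

theorem mixDensity_pow_mul_prodWeight (β y : ℝ) (x : ι → ℤˣ) :
    2 ^ Fintype.card ι * (mixDensity β y ^ Fintype.card ι * prodWeight (Real.tanh y) x) =
      Real.exp ((∑ i, spin x i) * y - Fintype.card ι * (2 * β)⁻¹ * y ^ 2) := by
  have h1 : 2 ^ Fintype.card ι * (mixDensity β y ^ Fintype.card ι * prodWeight (Real.tanh y) x) =
      ∏ i, 2 * (mixDensity β y * ((1 + Real.tanh y * spin x i) / 2)) := by
    rw [Finset.prod_mul_distrib, Finset.prod_mul_distrib, Finset.prod_const, Finset.prod_const,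
      prodWeight, Finset.card_univ]
  have h2 : ∀ i, 2 * (mixDensity β y * ((1 + Real.tanh y * spin x i) / 2)) =
      Real.exp (y * spin x i - (2 * β)⁻¹ * y ^ 2) := by
    intro i
    rw [sub_eq_add_neg, Real.exp_add, ← one_add_tanh_mul_spin, mixDensity, neg_mul]
    ring
  rw [h1, Finset.prod_congr rfl fun i _ => h2 i, ← Real.exp_sum, Finset.sum_sub_distrib,
    ← Finset.mul_sum, Finset.sum_const, Finset.card_univ, nsmul_eq_mul]
  congr 1
  ring

variable [Nonempty ι]

theorem integrable_mixDensity_mul_prodWeight {β : ℝ} (hβ : 0 < β) (x : ι → ℤˣ) :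
    Integrable fun y => mixDensity β y ^ Fintype.card ι * prodWeight (Real.tanh y) x := by
  have hM : (0 : ℝ) < Fintype.card ι := by exact_mod_cast Fintype.card_pos
  have h := (integrable_exp_linear_sub_sq (b := Fintype.card ι * (2 * β)⁻¹) (by positivity)
    (∑ i, spin x i)).const_mul (2 ^ Fintype.card ι)⁻¹
  refine h.congr (Eventually.of_forall fun y => ?_)
  simp only [← mixDensity_pow_mul_prodWeight]
  field_simp

/-- Hubbard–Stratonovich: integrating over y completes the square, and b = M/(2β) is chosen so that
S²/(4b) = βS²/(2M). The factor κ does not depend on x, so it cancels after normalization. -/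
theorem exists_weight_eq {β : ℝ} (hβ : 0 < β) : ∃ κ : ℝ, 0 < κ ∧ ∀ x : ι → ℤˣ, weight β x =
    κ * ∫ y, mixDensity β y ^ Fintype.card ι * prodWeight (Real.tanh y) x := by
  have hM : (0 : ℝ) < Fintype.card ι := by exact_mod_cast Fintype.card_pos
  have hb : 0 < Fintype.card ι * (2 * β)⁻¹ := by positivity
  have hpi := Real.pi_pos
  have hs : 0 < √(Real.pi / (Fintype.card ι * (2 * β)⁻¹)) := by positivity
  refine ⟨(√(Real.pi / (Fintype.card ι * (2 * β)⁻¹)))⁻¹ * 2 ^ Fintype.card ι, by positivity,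
    fun x => ?_⟩
  rw [mul_assoc, ← integral_const_mul]
  simp only [mixDensity_pow_mul_prodWeight]
  rw [integral_exp_linear_sub_sq hb, inv_mul_cancel_left₀ hs.ne', weight]
  congr 1
  simp only [spin]
  field_simp
  ring

variable [DecidableEq ι]

/-- Transfers a bound valid under every product law to the Curie–Weiss law, averaging k over the
mixing density. -/
theorem sum_weight_mul_le {β : ℝ} (hβ : 0 < β) {k : ℝ → ℝ} (hk : Continuous k) {K : ℝ} (hk0 : ∀ y, 0 ≤ k y)
    (hkK : ∀ y, k y ≤ K) {φ : (ι → ℤˣ) → ℝ} {a : ℝ}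
    (h : ∀ y, ∑ x, prodWeight (Real.tanh y) x * φ x ≤ a + k y) :
    ∑ x, (partitionFunction β ι)⁻¹ * weight β x * φ x ≤ a +
      (∫ y, k y * mixDensity β y ^ Fintype.card ι) / ∫ y, mixDensity β y ^ Fintype.card ι := by
  obtain ⟨κ, hκ, hw⟩ := exists_weight_eq (ι := ι) hβ
  have hsum : ∀ ψ : (ι → ℤˣ) → ℝ, ∑ x, weight β x * ψ x =
      κ * ∫ y, mixDensity β y ^ Fintype.card ι * ∑ x, prodWeight (Real.tanh y) x * ψ x := by
    intro ψ
    simp only [Finset.mul_sum]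
    rw [integral_finsetSum, Finset.mul_sum]
    · refine Finset.sum_congr rfl fun x _ => ?_
      rw [hw x, mul_assoc, ← integral_mul_const]
      simp only [mul_assoc]
    · intro x _
      simp only [← mul_assoc]
      exact (integrable_mixDensity_mul_prodWeight hβ x).mul_const _
  have hint : ∀ ψ : (ι → ℤˣ) → ℝ, Integrable fun y =>
      mixDensity β y ^ Fintype.card ι * ∑ x, prodWeight (Real.tanh y) x * ψ x := by
    intro ψ
    simp only [Finset.mul_sum]
    refine integrable_finsetSum _ fun x _ => ?_
    simp only [← mul_assoc]
    exact (integrable_mixDensity_mul_prodWeight hβ x).mul_const _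
  have hpow : Integrable fun y => mixDensity β y ^ Fintype.card ι := by
    simpa [sum_prodWeight] using hint 1
  have hkpow : Integrable fun y => k y * mixDensity β y ^ Fintype.card ι := by
    refine hpow.bdd_mul (c := K) hk.aestronglyMeasurable (Eventually.of_forall fun y => ?_)
    rw [Real.norm_eq_abs, abs_of_nonneg (hk0 y)]
    exact hkK y
  have hZ : partitionFunction β ι = κ * ∫ y, mixDensity β y ^ Fintype.card ι := by
    simpa [sum_prodWeight, partitionFunction] using hsum 1
  have hZpos : 0 < partitionFunction β ι :=
    Finset.sum_pos (fun x _ => Real.exp_pos _) Finset.univ_nonempty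
  have hIpos : 0 < ∫ y, mixDensity β y ^ Fintype.card ι := by
    rw [hZ] at hZpos
    exact (mul_pos_iff_of_pos_left hκ).1 hZpos
  have hle : ∫ y, mixDensity β y ^ Fintype.card ι * ∑ x, prodWeight (Real.tanh y) x * φ x ≤
      a * (∫ y, mixDensity β y ^ Fintype.card ι) +
        ∫ y, k y * mixDensity β y ^ Fintype.card ι := by
    rw [← integral_const_mul, ← integral_add (hpow.const_mul a) hkpow]
    refine integral_mono (hint φ) ((hpow.const_mul a).add hkpow) fun y => ?_
    have h1 := mul_le_mul_of_nonneg_left (h y) (pow_nonneg (mixDensity_pos β y).le (Fintype.card ι))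
    simp only
    linarith
  simp only [mul_assoc]
  rw [← Finset.mul_sum, hsum, hZ, mul_inv, mul_mul_mul_comm, inv_mul_cancel₀ hκ.ne', one_mul,
    inv_mul_le_iff₀ hIpos]
  refine hle.trans_eq ?_
  field_simp

end Mixture

theorem partitionFunction_pos (β : ℝ) (ι : Type*) [Fintype ι] [DecidableEq ι] :
    0 < partitionFunction β ι :=
  Finset.sum_pos (fun _ _ => Real.exp_pos _) Finset.univ_nonempty

/-- The Curie-Weiss probability of the configuration `x`. -/
def gibbs (β : ℝ) {ι : Type*} [Fintype ι] [DecidableEq ι] (x : ι → ℤˣ) : ℝ :=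
  (partitionFunction β ι)⁻¹ * weight β x

theorem gibbs_nonneg (β : ℝ) {ι : Type*} [Fintype ι] [DecidableEq ι] (x : ι → ℤˣ) :
    0 ≤ gibbs β x :=
  mul_nonneg (inv_nonneg.2 (partitionFunction_pos β ι).le) (Real.exp_pos _).le

theorem sum_gibbs (β : ℝ) (ι : Type*) [Fintype ι] [DecidableEq ι] :
    ∑ x : ι → ℤˣ, gibbs β x = 1 := by
  simp only [gibbs]
  rw [← Finset.mul_sum]
  exact inv_mul_cancel₀ (partitionFunction_pos β ι).ne'

/-- The Gaussian mixture requires β > 0; at β = 0 the spins are already independent and fair. -/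
theorem gibbs_zero {ι : Type*} [Fintype ι] [DecidableEq ι] (x : ι → ℤˣ) :
    gibbs 0 x = prodWeight 0 x := by
  have h : ∀ y : ι → ℤˣ, prodWeight 0 y = (1 / 2) ^ Fintype.card ι := fun y => by
    simp [prodWeight]
  have hs := sum_prodWeight (ι := ι) 0
  simp only [h, Finset.sum_const, nsmul_eq_mul] at hs
  rw [h, gibbs, partitionFunction]
  simp only [weight, zero_div, zero_mul, Real.exp_zero, mul_one, Finset.sum_const, nsmul_eq_mul]
  exact inv_eq_of_mul_eq_one_right hs

/-! ### Convergence of the eigenvalue distribution -/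

/-- The integral of `f` against the eigenvalue distribution of the configuration `x`. -/
def empirical {N : ℕ} (f : ℝ → ℂ) (x : Fin N × Fin N → ℤˣ) : ℂ :=
  (N : ℂ)⁻¹ * ∑ k, f ((normalizedMatrix_isHermitian (spin x)).eigenvalues k)

theorem empirical_inv_sub {N : ℕ} (z : ℂ) (x : Fin N × Fin N → ℤˣ) :
    empirical (fun r => ((r : ℂ) - z)⁻¹) x = spinStieltjes z x := by
  rw [empirical, spinStieltjes, spinGreen, trace_green]

theorem norm_empirical_le {N : ℕ} {f : ℝ → ℂ} {C : ℝ} (hf : ∀ r, ‖f r‖ ≤ C)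
    (x : Fin N × Fin N → ℤˣ) : ‖empirical f x‖ ≤ C := by
  have hC : 0 ≤ C := (norm_nonneg _).trans (hf 0)
  rw [empirical, norm_mul, norm_inv, Complex.norm_natCast]
  have h : ‖∑ k, f ((normalizedMatrix_isHermitian (spin x)).eigenvalues k)‖ ≤ N * C := by
    refine (norm_sum_le _ _).trans ((Finset.sum_le_sum fun k _ => hf _).trans ?_)
    simp
  rcases N.eq_zero_or_pos with h0 | h0
  · subst h0; simp [hC]
  · rwa [inv_mul_le_iff₀ (by positivity)]

/-- The mean distance between the integrals of `f` against the eigenvalue distribution and against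
the semicircle distribution. -/
def discrepancy (β v : ℝ) (N : ℕ) (f : ℝ → ℂ) : ℝ :=
  ∑ x : Fin N × Fin N → ℤˣ, gibbs β x * ‖empirical f x - ∫ r, f r ∂semicircle v‖

theorem discrepancy_nonneg (β v : ℝ) (N : ℕ) (f : ℝ → ℂ) : 0 ≤ discrepancy β v N f :=
  Finset.sum_nonneg fun x _ => mul_nonneg (gibbs_nonneg β x) (norm_nonneg _)

theorem tendsto_discrepancy_inv_sub {β m : ℝ} (hβ : 0 ≤ β) (hm : IsMagnetization β m) {z : ℂ}
    (hz : 0 < z.im) :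
    Tendsto (fun N => discrepancy β (1 - m ^ 2) N fun r => ((r : ℂ) - z)⁻¹) atTop (𝓝 0) := by
  have hv : 0 < 1 - m ^ 2 := by linarith [hm.sq_lt_one]
  have hi : 0 < z.im⁻¹ := inv_pos.2 hz
  set a : ℕ → ℝ := fun N => z.im⁻¹ * √(defectConst z * (√(N : ℝ))⁻¹) with ha
  have hpoint : ∀ N : ℕ, 0 < N → ∀ t : ℝ, |t| ≤ 1 →
      ∑ x : Fin N × Fin N → ℤˣ, prodWeight t x *
        ‖spinStieltjes z x - semicircleStieltjes (1 - m ^ 2) z‖ ≤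
      a N + z.im⁻¹ ^ 3 * |t ^ 2 - m ^ 2| := by
    intro N hN t ht
    have h1 : ∀ x : Fin N × Fin N → ℤˣ,
        ‖spinStieltjes z x - semicircleStieltjes (1 - m ^ 2) z‖ ≤
        z.im⁻¹ * ‖defect z t x‖ + z.im⁻¹ ^ 3 * |t ^ 2 - m ^ 2| := by
      intro x
      refine (norm_sub_semicircleStieltjes_le hv hz (spinStieltjes_im_nonneg hz x)).trans ?_
      -- Replacing the variance 1 - t² by 1 - m² costs |t² - m²| |s|², which the mixing density
      -- makes small on average.
      have e : 1 + z * spinStieltjes z x + ((1 - m ^ 2 : ℝ) : ℂ) * spinStieltjes z x ^ 2 =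
          defect z t x + ((t ^ 2 - m ^ 2 : ℝ) : ℂ) * spinStieltjes z x ^ 2 := by
        rw [defect]; push_cast; ring
      rw [e]
      have h2 : ‖defect z t x + ((t ^ 2 - m ^ 2 : ℝ) : ℂ) * spinStieltjes z x ^ 2‖ ≤
          ‖defect z t x‖ + |t ^ 2 - m ^ 2| * z.im⁻¹ ^ 2 := by
        refine (norm_add_le _ _).trans ?_
        rw [norm_mul, Complex.norm_real, Real.norm_eq_abs, norm_pow]
        have := norm_spinStieltjes_le hz x
        gcongr
      refine (mul_le_mul_of_nonneg_left h2 hi.le).trans_eq ?_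
      ring
    calc _ ≤ ∑ x : Fin N × Fin N → ℤˣ, prodWeight t x *
          (z.im⁻¹ * ‖defect z t x‖ + z.im⁻¹ ^ 3 * |t ^ 2 - m ^ 2|) :=
          Finset.sum_le_sum fun x _ => mul_le_mul_of_nonneg_left (h1 x) (prodWeight_nonneg ht x)
      _ = z.im⁻¹ * (∑ x : Fin N × Fin N → ℤˣ, prodWeight t x * ‖defect z t x‖) +
          z.im⁻¹ ^ 3 * |t ^ 2 - m ^ 2| := by
          simp only [mul_add, Finset.sum_add_distrib, ← Finset.sum_mul, sum_prodWeight, one_mul,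
            Finset.mul_sum]
          congr 1
          exact Finset.sum_congr rfl fun x _ => by ring
      _ ≤ _ := by
          have := sum_prodWeight_norm_defect_le hz hN ht
          simp only [ha]
          gcongr
  have halim : Tendsto a atTop (𝓝 0) := by
    have h1 : Tendsto (fun N : ℕ => (√(N : ℝ))⁻¹) atTop (𝓝 0) :=
      tendsto_inv_atTop_zero.comp (Real.tendsto_sqrt_atTop.comp tendsto_natCast_atTop_atTop)
    have h2 := ((h1.const_mul (defectConst z)).sqrt).const_mul z.im⁻¹
    simp only [mul_zero, Real.sqrt_zero] at h2
    exact h2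
  have hdisc : ∀ N, discrepancy β (1 - m ^ 2) N (fun r => ((r : ℂ) - z)⁻¹) =
      ∑ x : Fin N × Fin N → ℤˣ, gibbs β x *
        ‖spinStieltjes z x - semicircleStieltjes (1 - m ^ 2) z‖ := by
    intro N
    rw [discrepancy]
    simp only [empirical_inv_sub]
    rfl
  rcases hβ.eq_or_lt with h0 | h0
  · subst h0
    have hm0 : m = 0 := by
      rcases hm with ⟨-, h⟩ | ⟨h, -⟩
      · exact h
      · linarith
    refine squeeze_zero' (Eventually.of_forall fun N => discrepancy_nonneg _ _ _ _) ?_ halim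
    filter_upwards [eventually_gt_atTop 0] with N hN
    rw [hdisc]
    simp only [gibbs_zero]
    have := hpoint N hN 0 (by simp)
    simpa [hm0] using this
  · set k : ℝ → ℝ := fun y => z.im⁻¹ ^ 3 * |Real.tanh y ^ 2 - m ^ 2| with hk
    have hkc : Continuous k := continuous_const.mul ((continuous_tanh.pow 2).sub continuous_const).abs
    have hk0 : ∀ y, 0 ≤ k y := fun y => by positivity
    have hkK : ∀ y, k y ≤ z.im⁻¹ ^ 3 := by
      intro y
      have h1 : |Real.tanh y ^ 2 - m ^ 2| ≤ 1 := by
        rw [abs_le]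
        have := Real.tanh_sq_lt_one y
        constructor <;> nlinarith [sq_nonneg (Real.tanh y), sq_nonneg m]
      calc k y ≤ z.im⁻¹ ^ 3 * 1 := mul_le_mul_of_nonneg_left h1 (by positivity)
        _ = _ := mul_one _
    have hlap := tendsto_laplace (continuous_mixDensity β) (mixDensity_pos β)
      (integrable_mixDensity h0) (tendsto_mixDensity_cocompact h0) hkc hk0 hkK fun y₀ hy₀ => by
        simp only [hk]
        rw [tanh_sq_of_mixDensity_max h0 hm hy₀, sub_self, abs_zero, mul_zero]
    -- Laplace's method is applied along the number of spins, which is N².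
    have hsq : Tendsto (fun N : ℕ => N * N) atTop atTop :=
      tendsto_id.atTop_mul_atTop₀ tendsto_id
    have hlim := halim.add (hlap.comp hsq)
    rw [add_zero] at hlim
    refine squeeze_zero' (Eventually.of_forall fun N => discrepancy_nonneg _ _ _ _) ?_ hlim
    filter_upwards [eventually_gt_atTop 0] with N hN
    have : Nonempty (Fin N) := ⟨⟨0, hN⟩⟩
    rw [hdisc]
    have := sum_weight_mul_le (ι := Fin N × Fin N) h0 hkc hk0 hkK (a := a N)
      (φ := fun x => ‖spinStieltjes z x - semicircleStieltjes (1 - m ^ 2) z‖)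
      fun y => hpoint N hN (Real.tanh y) (Real.abs_tanh_lt_one y).le
    simpa [gibbs] using this

theorem discrepancy_add_le (β : ℝ) {v : ℝ} (N : ℕ) {f g : ℝ → ℂ}
    (hf : Integrable f (semicircle v)) (hg : Integrable g (semicircle v)) :
    discrepancy β v N (fun r => f r + g r) ≤ discrepancy β v N f + discrepancy β v N g := by
  rw [discrepancy, discrepancy, discrepancy, ← Finset.sum_add_distrib]
  refine Finset.sum_le_sum fun x _ => ?_
  rw [← mul_add]
  refine mul_le_mul_of_nonneg_left ?_ (gibbs_nonneg β x)
  rw [integral_add hf hg]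
  have e : empirical (fun r => f r + g r) x = empirical f x + empirical g x := by
    rw [empirical, empirical, empirical, Finset.sum_add_distrib, mul_add]
  rw [e, add_sub_add_comm]
  exact norm_add_le _ _

theorem discrepancy_smul (β v : ℝ) (N : ℕ) (c : ℂ) (f : ℝ → ℂ) :
    discrepancy β v N (fun r => c * f r) = ‖c‖ * discrepancy β v N f := by
  rw [discrepancy, discrepancy, Finset.mul_sum]
  refine Finset.sum_congr rfl fun x _ => ?_
  have e : empirical (fun r => c * f r) x = c * empirical f x := by
    rw [empirical, empirical, ← Finset.mul_sum]; ring
  rw [integral_const_mul, e, ← mul_sub, norm_mul]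
  ring

theorem discrepancy_conj (β v : ℝ) (N : ℕ) (f : ℝ → ℂ) :
    discrepancy β v N (fun r => starRingEnd ℂ (f r)) = discrepancy β v N f := by
  rw [discrepancy, discrepancy]
  refine Finset.sum_congr rfl fun x _ => ?_
  have e : empirical (fun r => starRingEnd ℂ (f r)) x = starRingEnd ℂ (empirical f x) := by
    rw [empirical, empirical, map_mul, map_sum, map_inv₀, map_natCast]
  rw [integral_conj, e, ← map_sub, RCLike.norm_conj]

theorem discrepancy_le (β : ℝ) {v : ℝ} (hv : 0 < v) (N : ℕ) {f : ℝ → ℂ} {C : ℝ}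
    (hf : ∀ r, ‖f r‖ ≤ C) : discrepancy β v N f ≤ 2 * C := by
  have := isProbabilityMeasure_semicircle hv
  have h : ∀ x : Fin N × Fin N → ℤˣ, ‖empirical f x - ∫ r, f r ∂semicircle v‖ ≤ 2 * C := by
    intro x
    refine (norm_sub_le _ _).trans ?_
    have h1 := norm_empirical_le hf x
    have h2 := norm_integral_le_of_norm_le_const (μ := semicircle v) (Eventually.of_forall hf)
    rw [probReal_univ, mul_one] at h2
    linarith
  calc discrepancy β v N f ≤ ∑ x : Fin N × Fin N → ℤˣ, gibbs β x * (2 * C) :=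
        Finset.sum_le_sum fun x _ => mul_le_mul_of_nonneg_left (h x) (gibbs_nonneg β x)
    _ = 2 * C := by rw [← Finset.sum_mul, sum_gibbs, one_mul]

theorem discrepancy_one (β : ℝ) {v : ℝ} (hv : 0 < v) {N : ℕ} (hN : 0 < N) :
    discrepancy β v N (fun _ => 1) = 0 := by
  rw [discrepancy]
  refine Finset.sum_eq_zero fun x _ => ?_
  have hN' : (N : ℂ) ≠ 0 := by exact_mod_cast hN.ne'
  rw [integral_one_semicircle hv, empirical]
  simp [hN']

theorem integrable_semicircle {v : ℝ} (hv : 0 < v) {f : ℝ → ℂ} (hf : Continuous f) {C : ℝ}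
    (hC : ∀ r, ‖f r‖ ≤ C) : Integrable f (semicircle v) := by
  have := isFiniteMeasure_semicircle hv
  exact Integrable.of_bound hf.aestronglyMeasurable C (Eventually.of_forall hC)

/-- The discrepancy as a seminorm. -/
def discrepancySeminorm (β : ℝ) {v : ℝ} (hv : 0 < v) (N : ℕ) : Seminorm ℂ C(OnePoint ℝ, ℂ) :=
  Seminorm.of (fun f => discrepancy β v N fun r => f (r : OnePoint ℝ))
    (fun f g => discrepancy_add_le β N
      (integrable_semicircle hv (f.continuous.comp OnePoint.continuous_coe)
        fun r => f.norm_coe_le_norm r)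
      (integrable_semicircle hv (g.continuous.comp OnePoint.continuous_coe)
        fun r => g.norm_coe_le_norm r))
    fun c _ => discrepancy_smul β v N c _

theorem tendsto_discrepancy_onePoint {β m : ℝ} (hβ : 0 ≤ β) (hm : IsMagnetization β m)
    (f : C(OnePoint ℝ, ℂ)) :
    Tendsto (fun N => discrepancy β (1 - m ^ 2) N fun r => f (r : OnePoint ℝ)) atTop (𝓝 0) := by
  have hv : 0 < 1 - m ^ 2 := by linarith [hm.sq_lt_one]
  refine tendsto_seminorm (D := discrepancySeminorm β hv) (fun N f => ?_) (fun N _ => ?_) ?_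
    (fun z hz => tendsto_discrepancy_inv_sub hβ hm hz) f
  · exact discrepancy_le β hv N fun r => f.norm_coe_le_norm r
  · exact discrepancy_conj β _ N _
  · refine tendsto_const_nhds.congr' ?_
    filter_upwards [eventually_gt_atTop 0] with N hN
    exact (discrepancy_one β hv hN).symm

/-- A continuous cutoff function that is `1` on `[-R, R]`. -/
def cutoff (R r : ℝ) : ℝ := max 0 (min 1 (R + 1 - |r|))

theorem continuous_cutoff (R : ℝ) : Continuous (cutoff R) := by unfold cutoff; fun_prop

theorem cutoff_le_one (R r : ℝ) : cutoff R r ≤ 1 := max_le zero_le_one (min_le_left _ _)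

theorem cutoff_eq_one {R r : ℝ} (h : |r| ≤ R) : cutoff R r = 1 := by
  rw [cutoff, min_eq_left (by linarith), max_eq_right zero_le_one]

theorem cutoff_eq_zero {R r : ℝ} (h : R + 1 ≤ |r|) : cutoff R r = 0 := by
  rw [cutoff, max_eq_left]
  exact (min_le_right _ _).trans (by linarith)

theorem tendsto_discrepancy_mul_cutoff {β m : ℝ} (hβ : 0 ≤ β) (hm : IsMagnetization β m)
    {f : ℝ → ℂ} (hf : Continuous f) (R : ℝ) :
    Tendsto (fun N => discrepancy β (1 - m ^ 2) N fun r => f r * cutoff R r) atTop (𝓝 0) := by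
  have hlim : Tendsto (fun r => f r * cutoff R r) (coclosedCompact ℝ) (𝓝 0) := by
    rw [coclosedCompact_eq_cocompact]
    refine tendsto_const_nhds.congr' ?_
    filter_upwards [(tendsto_norm_cocompact_atTop (E := ℝ)).eventually_ge_atTop (R + 1)] with r hr
    rw [cutoff_eq_zero (by simpa using hr)]
    simp
  exact tendsto_discrepancy_onePoint hβ hm (OnePoint.continuousMapMk
    ⟨fun r => f r * cutoff R r, hf.mul (Complex.continuous_ofReal.comp (continuous_cutoff R))⟩ 0 hlim)

/-- The cutoff equals 1 on the whole support [-2√v, 2√v]. -/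
theorem integral_semicircle_mul_cutoff {v : ℝ} (hv : 0 < v) {f : ℝ → ℂ} (hf : Continuous f) :
    ∫ r, f r * cutoff (2 * √v) r ∂semicircle v = ∫ r, f r ∂semicircle v := by
  have hc : Continuous fun r => f r * (cutoff (2 * √v) r : ℂ) :=
    hf.mul (Complex.continuous_ofReal.comp (continuous_cutoff _))
  rw [integral_semicircle hv hf, integral_semicircle hv hc]
  congr 1
  refine intervalIntegral.integral_congr fun θ _ => ?_
  have h : |2 * √v * Real.cos θ| ≤ 2 * √v := by
    rw [abs_mul, abs_of_nonneg (show 0 ≤ 2 * √v by positivity)]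
    exact mul_le_of_le_one_right (by positivity) (Real.abs_cos_le_one θ)
  simp only [cutoff_eq_one h, Complex.ofReal_one, mul_one]

/-- The error of truncating f is at most C times the empirical mass lost to the cutoff. That mass
tends to 0 because the cutoff has semicircle integral 1; this supplies tightness. -/
theorem norm_empirical_sub_mul_cutoff_le {N : ℕ} (hN : 0 < N) {f : ℝ → ℂ} {C : ℝ}
    (hf : ∀ r, ‖f r‖ ≤ C) (R : ℝ) (x : Fin N × Fin N → ℤˣ) :
    ‖empirical f x - empirical (fun r => f r * cutoff R r) x‖ ≤
      C * ‖empirical (fun r => (1 : ℂ) * cutoff R r) x - 1‖ := by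
  have hN' : (N : ℂ) ≠ 0 := by exact_mod_cast hN.ne'
  set l := (normalizedMatrix_isHermitian (spin x)).eigenvalues with hl
  have e1 : empirical f x - empirical (fun r => f r * cutoff R r) x =
      (N : ℂ)⁻¹ * ∑ k, f (l k) * ((1 - cutoff R (l k) : ℝ) : ℂ) := by
    rw [empirical, empirical, ← mul_sub, ← Finset.sum_sub_distrib]
    congr 1
    exact Finset.sum_congr rfl fun k _ => by push_cast; ring
  have e2 : empirical (fun r => (1 : ℂ) * cutoff R r) x - 1 =
      -((N : ℂ)⁻¹ * ((∑ k, (1 - cutoff R (l k)) : ℝ) : ℂ)) := by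
    rw [empirical]
    push_cast
    simp only [one_mul, Finset.sum_sub_distrib, Finset.sum_const, Finset.card_univ,
      Fintype.card_fin, nsmul_eq_mul, mul_one]
    field_simp
    ring
  have hnn : ∀ k, 0 ≤ 1 - cutoff R (l k) := fun k => by linarith [cutoff_le_one R (l k)]
  rw [e1, e2, norm_neg, norm_mul, norm_mul, Complex.norm_real, Real.norm_eq_abs,
    abs_of_nonneg (Finset.sum_nonneg fun k _ => hnn k), mul_left_comm]
  refine mul_le_mul_of_nonneg_left ((norm_sum_le _ _).trans ?_) (norm_nonneg _)
  rw [Finset.mul_sum]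
  refine Finset.sum_le_sum fun k _ => ?_
  rw [norm_mul, Complex.norm_real, Real.norm_eq_abs, abs_of_nonneg (hnn k)]
  exact mul_le_mul_of_nonneg_right (hf _) (hnn k)

theorem tendsto_discrepancy {β m : ℝ} (hβ : 0 ≤ β) (hm : IsMagnetization β m) {f : ℝ → ℂ}
    (hf : Continuous f) {C : ℝ} (hC : ∀ r, ‖f r‖ ≤ C) :
    Tendsto (fun N => discrepancy β (1 - m ^ 2) N f) atTop (𝓝 0) := by
  have hv : 0 < 1 - m ^ 2 := by linarith [hm.sq_lt_one]
  set R := 2 * √(1 - m ^ 2)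
  have h1 := tendsto_discrepancy_mul_cutoff hβ hm hf R
  have h2 := tendsto_discrepancy_mul_cutoff hβ hm (continuous_const (y := (1 : ℂ))) R
  have hlim := h1.add (h2.const_mul C)
  rw [mul_zero, add_zero] at hlim
  refine squeeze_zero' (Eventually.of_forall fun N => discrepancy_nonneg _ _ _ _) ?_ hlim
  filter_upwards [eventually_gt_atTop 0] with N hN
  rw [discrepancy, discrepancy, discrepancy, Finset.mul_sum, ← Finset.sum_add_distrib]
  refine Finset.sum_le_sum fun x _ => ?_
  rw [mul_left_comm, ← mul_add]
  refine mul_le_mul_of_nonneg_left ?_ (gibbs_nonneg β x)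
  rw [integral_semicircle_mul_cutoff hv hf, integral_semicircle_mul_cutoff hv continuous_const,
    integral_one_semicircle hv]
  have h3 := norm_empirical_sub_mul_cutoff_le hN hC R x
  have h4 := norm_add_le (empirical f x - empirical (fun r => f r * cutoff R r) x)
    (empirical (fun r => f r * cutoff R r) x - ∫ r, f r ∂semicircle (1 - m ^ 2))
  rw [sub_add_sub_cancel] at h4
  linarith

/-! ### Passage to the probability space -/

/-- Markov's inequality over the finitely many configurations, whose probabilities sum to 1 and so
exhaust `P`. -/
theorem IsCurieWeiss.measure_le {β : ℝ} {ι : Type*} [Fintype ι] [DecidableEq ι] {Ω : Type*}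
    [MeasurableSpace Ω] {P : Measure Ω} [IsProbabilityMeasure P] {ξ : ι → Ω → ℝ}
    (h : IsCurieWeiss β P ξ) {Φ : (ι → ℝ) → ℝ} {ε : ℝ} (hε : 0 < ε) :
    P {ω | ε < |Φ fun i => ξ i ω|} ≤
      ENNReal.ofReal (ε⁻¹ * ∑ x : ι → ℤˣ, gibbs β x * |Φ (spin x)|) := by
  classical
  set A : (ι → ℤˣ) → Set Ω := fun x => {ω | ∀ i, ξ i ω = spin x i} with hA
  have hPA : ∀ x, P (A x) = ENNReal.ofReal (gibbs β x) := h.prob_eq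
  have hmeas : ∀ x, MeasurableSet (A x) := fun x => by
    simp only [hA, Set.ofPred_forall]
    exact MeasurableSet.iInter fun i => h.measurable i (measurableSet_singleton _)
  have hdisj : Pairwise (Function.onFun Disjoint A) := by
    intro x y hxy
    refine Set.disjoint_left.2 fun ω hx hy => hxy (funext fun i => ?_)
    have h1 : spin x i = spin y i := (hx i).symm.trans (hy i)
    simp only [spin, Int.cast_inj] at h1
    exact Units.ext h1
  have hU : P (⋃ x, A x) = 1 := by
    rw [measure_iUnion hdisj hmeas, tsum_fintype]
    simp only [hPA]
    rw [← ENNReal.ofReal_sum_of_nonneg fun x _ => gibbs_nonneg β x, sum_gibbs, ENNReal.ofReal_one]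
  have hc : P (⋃ x, A x)ᶜ = 0 := by
    rw [prob_compl_eq_zero_iff (MeasurableSet.iUnion hmeas)]
    exact hU
  -- `Φ` is arbitrary, so the event need not be measurable; covering it by atoms and a null set uses
  -- only subadditivity.
  have hsub : {ω | ε < |Φ fun i => ξ i ω|} ⊆
      (⋃ x ∈ Finset.univ.filter fun x : ι → ℤˣ => ε < |Φ (spin x)|, A x) ∪ (⋃ x, A x)ᶜ := by
    intro ω hω
    by_cases hm : ω ∈ ⋃ x, A x
    · left
      obtain ⟨x, hx⟩ := Set.mem_iUnion.1 hm
      have e : (fun i => ξ i ω) = spin x := funext hx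
      simp only [Set.mem_ofPred_eq, e] at hω
      simp only [Set.mem_iUnion]
      exact ⟨x, by simpa using hω, hx⟩
    · right; exact hm
  calc P {ω | ε < |Φ fun i => ξ i ω|}
      ≤ P (⋃ x ∈ Finset.univ.filter fun x : ι → ℤˣ => ε < |Φ (spin x)|, A x) +
        P (⋃ x, A x)ᶜ := (measure_mono hsub).trans (measure_union_le _ _)
    _ ≤ ∑ x ∈ Finset.univ.filter (fun x : ι → ℤˣ => ε < |Φ (spin x)|), P (A x) := by
        rw [hc, add_zero]
        exact measure_biUnion_finset_le _ _
    _ ≤ ∑ x ∈ Finset.univ.filter (fun x : ι → ℤˣ => ε < |Φ (spin x)|),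
        ENNReal.ofReal (ε⁻¹ * (gibbs β x * |Φ (spin x)|)) := by
        refine Finset.sum_le_sum fun x hx => ?_
        rw [hPA]
        refine ENNReal.ofReal_le_ofReal ?_
        have hx' : ε < |Φ (spin x)| := (Finset.mem_filter.1 hx).2
        rw [mul_left_comm]
        refine le_mul_of_one_le_right (gibbs_nonneg β x) ?_
        rw [← div_eq_inv_mul, one_le_div hε]
        exact hx'.le
    _ ≤ ∑ x : ι → ℤˣ, ENNReal.ofReal (ε⁻¹ * (gibbs β x * |Φ (spin x)|)) :=
        Finset.sum_le_sum_of_subset (Finset.filter_subset _ _)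
    _ = _ := by
        rw [Finset.mul_sum, ENNReal.ofReal_sum_of_nonneg]
        intro x _
        have := gibbs_nonneg β x
        positivity

theorem integral_eigenvalueDistribution {N : ℕ} (M : Matrix (Fin N) (Fin N) ℝ)
    (hM : M.IsHermitian) (f : ℝ →ᵇ ℝ) :
    ∫ r, f r ∂eigenvalueDistribution M hM = (N : ℝ)⁻¹ * ∑ k, f (hM.eigenvalues k) := by
  rw [eigenvalueDistribution, integral_smul_measure, integral_finsetSum_measure]
  · simp
  · intro k _
    exact integrable_dirac (by simp)

theorem tendstoWeaklyInProbability {β m : ℝ} (hβ : 0 ≤ β) (hm : IsMagnetization β m)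
    {Ω : ℕ → Type*} [∀ N, MeasurableSpace (Ω N)] (P : ∀ N, Measure (Ω N))
    [∀ N, IsProbabilityMeasure (P N)] (X : ∀ N, Fin N × Fin N → Ω N → ℝ)
    (hX : ∀ N, IsCurieWeiss β (P N) (X N)) :
    TendstoWeaklyInProbability P
      (fun N ω => eigenvalueDistribution (normalizedMatrix fun p => X N p ω)
        (normalizedMatrix_isHermitian fun p => X N p ω)) (semicircle (1 - m ^ 2)) := by
  intro f ε hε
  have hlim := tendsto_discrepancy hβ hm (f := fun r => (f r : ℂ))
    (Complex.continuous_ofReal.comp f.continuous) (C := ‖f‖)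
    (fun r => by rw [Complex.norm_real]; exact f.norm_coe_le_norm r)
  have hlim2 := ENNReal.tendsto_ofReal (hlim.const_mul ε⁻¹)
  rw [mul_zero, ENNReal.ofReal_zero] at hlim2
  refine tendsto_of_tendsto_of_tendsto_of_le_of_le tendsto_const_nhds hlim2
    (fun _ => zero_le) fun N => ?_
  refine ((hX N).measure_le (Φ := fun y => ∫ r, f r ∂eigenvalueDistribution (normalizedMatrix y)
    (normalizedMatrix_isHermitian y) - ∫ r, f r ∂semicircle (1 - m ^ 2)) hε).trans_eq ?_
  congr 2
  rw [discrepancy]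
  refine Finset.sum_congr rfl fun x _ => ?_
  rw [integral_eigenvalueDistribution, empirical, integral_complex_ofReal]
  rw [← Real.norm_eq_abs, ← Complex.norm_real, Complex.ofReal_sub]
  push_cast
  rfl

end CurieWeiss

end

theorem theorem7p7 (β : ℝ) (hβ : 0 ≤ β) :
    (∃! m : ℝ, CurieWeiss.IsMagnetization β m) ∧
    ∀ m : ℝ, CurieWeiss.IsMagnetization β m →
      ∀ {Ω : ℕ → Type*} [∀ N, MeasurableSpace (Ω N)] (P : ∀ N, Measure (Ω N))
        [∀ N, IsProbabilityMeasure (P N)] (X : ∀ N, Fin N × Fin N → Ω N → ℝ),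
        (∀ N, CurieWeiss.IsCurieWeiss β (P N) (X N)) →
          CurieWeiss.TendstoWeaklyInProbability P
            (fun N ω => CurieWeiss.eigenvalueDistribution
              (CurieWeiss.normalizedMatrix fun p => X N p ω)
              (CurieWeiss.normalizedMatrix_isHermitian fun p => X N p ω))
            (CurieWeiss.semicircle (1 - m ^ 2)) :=
  ⟨CurieWeiss.existsUnique_isMagnetization β, fun _ hm _ _ P _ X hX =>
    CurieWeiss.tendstoWeaklyInProbability hβ hm P X hX⟩
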